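/- **Setting.** Let $d\ge 1$, $1\le q\le 2$, $s,s'\in\mathbb R$ with $s'<s-\frac dq$, $\kappa>0$, $\alpha>0$, and put $\tau_q(s)=\frac sd+\frac12-\frac1q$. Let $\mathcal X\subset\mathbb R^d$, and let $\mathcal T\subset[0,\infty)$ be bounded and measurable, carrying Lebesgue measure, such that every non-empty relatively open subset of $\mathcal T$ has positive measure (e.g. an interval). Let $\mathcal Z=\mathcal X\times\mathcal T$, with points $\mathbf z=(\mathbf x,t)$ and the Euclidean distance. *Kernel.* Let $\mathcal C:\mathcal T\times\mathcal T\to\mathbb R$ be a continuous, symmetric, positive (semi-)definite kernel in $L^2(\mathcal T\times\mathcal T)$, whose integral operator on $L^2(\mathcal T)$ has eigen-pairs $(\lambda_j,\psi_j)_{j\ge1}$, $\lambda_j\ge0$, where $(\psi_j)$ is an orthonormal basis of $L^2(\mathcal T)$. *$q$-exponential process.* $\mathrm{q\text{-}ED}_J(0,A)$ is the law on $\mathbb R^J$ with density $$\tfrac q2(2\pi)^{-J/2}|A|^{-1/2}\,r^{(\frac q2-1)\frac J2}\exp\{-\tfrac12 r^{q/2}\},\qquad r=v^{\top}A^{-1}v;$$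 $\mathrm{q\text{-}ED}(0,\lambda)$ is the law of $\sqrt\lambda\,\zeta$ with $\zeta\sim\mathrm{q\text{-}ED}_1(0,1)$. A process $\xi(t)$, $t\in\mathcal T$, is a $\mathrm{q\text{-}EP}(0,\mathcal C)$ if either all its finite-dimensional distributions at distinct times are $(\xi(t_1),\dots,\xi(t_J))\sim\mathrm{q\text{-}ED}_J(0,[\mathcal C(t_i,t_j)])$, or it has the Karhunen–Loève series $\xi(t)=\sum_{j}a_j\psi_j(t)$, convergent in probability for every $t\in\mathcal T$, with independent $a_j\sim\mathrm{q\text{-}ED}(0,\lambda_j)$. *STBP.* Let $\xi_1,\xi_2,\dots$ be i.i.d. $\mathrm{q\text{-}EP}(0,\mathcal C)$, let $\phi_1,\phi_2,\ldots:\mathcal X\to\mathbb R$ (e.g. a spatial basis), $\gamma_\ell=\kappa\,\ell^{-\tau_q(s)}$, and $$u(\mathbf x,t)=\sum_{\ell\ge1}\gamma_\ell\,\xi_\ell(t)\,\phi_\ell(\mathbf x),$$ where $u(\mathbf z)$ is identified with the sequence $(\gamma_\ell\xi_\ell(t)\phi_\ell(\mathbf x))_\ell$ of its terms. *Value space.*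 $B^{s',q}(\mathcal Z)$ consists of the coefficient sequences $(v_\ell(\cdot))_\ell$ of functions on $\mathcal T$ with finite norm $\big(\sum_\ell \ell^{\tau_q(s')q}\|v_\ell\|_{L^q(\mathcal T)}^q\big)^{1/q}$; a sequence of numbers is regarded as a sequence of functions constant in time, so that its norm is $|\mathcal T|^{1/q}\big(\sum_\ell \ell^{\tau_q(s')q}|v_\ell|^q\big)^{1/q}$. **Theorem (Hölder continuity).** Suppose that $\sum_j\lambda_j^{q/2}<\infty$ and that there are constants $L(\phi_\ell),L(\psi_j)\ge0$ with 1. $|\phi_\ell(\mathbf x)-\phi_\ell(\mathbf x')|\le L(\phi_\ell)\,|\mathbf x-\mathbf x'|^{\alpha+\frac dq}$ for all $\mathbf x,\mathbf x'\in\mathcal X$, $\ \sum_\ell \ell^{\frac{s'-s}dq}L(\phi_\ell)^q<\infty$, $\ \sum_\ell \ell^{\frac{s'-s}dq}\|\phi_\ell\|_\infty^q<\infty$; 2. $|\psi_j(t)-\psi_j(t')|\le L(\psi_j)\,|t-t'|^{\alpha+\frac dq}$ for all $t,t'\in\mathcal T$, $\ \sum_j\lambda_j^{q/2}L(\psi_j)^q<\infty$.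 Then for every $0<\beta<\alpha$ the process $u$ has a version in $C^{0,\beta}(\mathcal Z,B^{s',q}(\mathcal Z))$: there is a measurable process $\tilde u$ with $\mathbb P[\tilde u(\mathbf z)=u(\mathbf z)]=1$ for every $\mathbf z\in\mathcal Z$, all of whose paths $\mathbf z\mapsto\tilde u(\mathbf z)$ are bounded and $\beta$-Hölder continuous in the norm of $B^{s',q}(\mathcal Z)$. -/

import Mathlib

namespace STBP

open MeasureTheory ProbabilityTheory Filter
open scoped ENNReal Topology

/-! Sequences indexed in the paper by `1, 2, 3, …` are indexed here by `ℕ`; the entry with index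
`ℓ : ℕ` has the weight `ℓ + 1`. -/

/-- Lebesgue measure on a set `T` of times. -/
noncomputable def timeMeasure (T : Set ℝ) : Measure T :=
  Measure.comap (Subtype.val : T → ℝ) volume

/-- `τ_q(s) = s / d + 1 / 2 - 1 / q`. -/
noncomputable def tau (d : ℕ) (q s : ℝ) : ℝ := s / d + 1 / 2 - 1 / q

/-- Density of the centred multivariate `q`-exponential distribution with scatter matrix `A`:
`(q/2) (2π)^(-J/2) |A|^(-1/2) r^((q/2-1)J/2) exp(-r^(q/2)/2)`, with `r = vᵀ A⁻¹ v`. -/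
noncomputable def qEDDensity (q : ℝ) {J : ℕ} (A : Matrix (Fin J) (Fin J) ℝ)
    (v : Fin J → ℝ) : ℝ :=
  q / 2 * (2 * Real.pi) ^ (-(J : ℝ) / 2) * A.det ^ (-(1 : ℝ) / 2)
    * (v ⬝ᵥ (A⁻¹.mulVec v)) ^ ((q / 2 - 1) * J / 2)
    * Real.exp (-((v ⬝ᵥ (A⁻¹.mulVec v)) ^ (q / 2)) / 2)

/-- The distribution `q-ED_J(0, A)` on `ℝ^J`. -/
noncomputable def qED (q : ℝ) {J : ℕ} (A : Matrix (Fin J) (Fin J) ℝ) : Measure (Fin J → ℝ) :=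
  volume.withDensity (fun v => ENNReal.ofReal (qEDDensity q A v))

/-- The one-dimensional distribution `q-ED(0, lam)`, `lam ≥ 0`: the law of `√lam · ζ` with
`ζ ~ q-ED(0, 1)` (a point mass at `0` if `lam = 0`). -/
noncomputable def qED1 (q lam : ℝ) : Measure ℝ :=
  (qED q (1 : Matrix (Fin 1) (Fin 1) ℝ)).map (fun v => Real.sqrt lam * v 0)

/-- `C` is a continuous covariance kernel on `T` whose Hilbert-Schmidt operator on `L²(T)` has the
eigen-pairs `(lam j, ψ j)`, the eigenfunctions forming an orthonormal basis of `L²(T)`. -/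
structure IsEigenSystem {T : Set ℝ} (C : T → T → ℝ) (lam : ℕ → ℝ) (ψ : ℕ → T → ℝ) : Prop where
  continuous : Continuous (Function.uncurry C)
  symm : ∀ t t', C t t' = C t' t
  nonneg : ∀ (J : ℕ) (t : Fin J → T) (c : Fin J → ℝ), 0 ≤ ∑ i, ∑ j, c i * c j * C (t i) (t j)
  hilbertSchmidt : MemLp (Function.uncurry C) 2 ((timeMeasure T).prod (timeMeasure T))
  eigenvalue_nonneg : ∀ j, 0 ≤ lam j
  memLp : ∀ j, MemLp (ψ j) 2 (timeMeasure T)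
  orthonormal : ∀ i j, ∫ t, ψ i t * ψ j t ∂(timeMeasure T) = if i = j then 1 else 0
  complete : ∀ f : T → ℝ, MemLp f 2 (timeMeasure T) →
    (∀ j, ∫ t, f t * ψ j t ∂(timeMeasure T) = 0) → f =ᵐ[timeMeasure T] 0
  eigen : ∀ j, ∀ᵐ t ∂(timeMeasure T), ∫ t', C t t' * ψ j t' ∂(timeMeasure T) = lam j * ψ j t

/-- `ξ` has finite-dimensional distributions `q-ED_J(0, [C(t_i, t_j)])` at distinct times. -/
def HasQEDMarginals {Ω : Type*} [MeasurableSpace Ω] (P : Measure Ω) {T : Set ℝ} (q : ℝ)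
    (C : T → T → ℝ) (ξ : T → Ω → ℝ) : Prop :=
  ∀ (J : ℕ) (t : Fin J → T), 0 < J → Function.Injective t →
    P.map (fun ω i => ξ (t i) ω) = qED q (Matrix.of fun i j => C (t i) (t j))

/-- `ξ(t) = ∑ j, a_j ψ_j(t)` with independent coefficients `a_j ~ q-ED(0, lam_j)`; the series
converges in probability at every time `t`. -/
def HasQEDSeries {Ω : Type*} [MeasurableSpace Ω] (P : Measure Ω) {T : Set ℝ} (q : ℝ)
    (lam : ℕ → ℝ) (ψ : ℕ → T → ℝ) (ξ : T → Ω → ℝ) : Prop :=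
  ∃ a : ℕ → Ω → ℝ, (∀ j, Measurable (a j)) ∧ iIndepFun a P ∧
    (∀ j, P.map (a j) = qED1 q (lam j)) ∧
    ∀ t, TendstoInMeasure P (fun n ω => ∑ j ∈ Finset.range n, a j ω * ψ j t) atTop (ξ t)

/-- `q`-exponential process `q-EP(0, C)`, where `C` has the eigen-pairs `(lam, ψ)`: it is given by
its finite-dimensional distributions or by its Karhunen-Loève series. Both describe the centred
Gaussian process with covariance `C` if `q = 2`; for `q ≠ 2` the distributions `q-ED_J` are not
consistent under marginalization, and the processes are those given by the series. -/
def IsQEP {Ω : Type*} [MeasurableSpace Ω] (P : Measure Ω) {T : Set ℝ} (q : ℝ)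
    (C : T → T → ℝ) (lam : ℕ → ℝ) (ψ : ℕ → T → ℝ) (ξ : T → Ω → ℝ) : Prop :=
  (∀ t, Measurable (ξ t)) ∧ (HasQEDMarginals P q C ξ ∨ HasQEDSeries P q lam ψ ξ)

/-- The random coefficients `ξ_ℓ(·)` are i.i.d. with law `q-EP(0, C)`. -/
def IsIIDQEP {Ω : Type*} [MeasurableSpace Ω] (P : Measure Ω) {T : Set ℝ} (q : ℝ)
    (C : T → T → ℝ) (lam : ℕ → ℝ) (ψ : ℕ → T → ℝ) (ξ : ℕ → T → Ω → ℝ) : Prop :=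
  (∀ ℓ, IsQEP P q C lam ψ (ξ ℓ)) ∧ iIndepFun (fun ℓ ω t => ξ ℓ t ω) P

/-- The norm `‖v‖_{s,q,p} = (∑ ℓ, ℓ^(τ_q(s) q) ‖v_ℓ(·)‖_{L^p(T)}^q)^(1/q)` of the space
`B^{s,q,p}(Z)`; an element of that space is identified with the sequence of its coefficient
functions `v_ℓ : T → ℝ` in the spatial basis. -/
noncomputable def besovNorm (d : ℕ) (T : Set ℝ) (s q p : ℝ) (v : ℕ → T → ℝ) : ℝ≥0∞ :=
  (∑' ℓ : ℕ, ENNReal.ofReal (((ℓ : ℝ) + 1) ^ (tau d q s * q))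
    * eLpNorm (v ℓ) (ENNReal.ofReal p) (timeMeasure T) ^ q) ^ (1 / q)

/-- The norm of `B^{s,q}(Z) = B^{s,q,q}(Z)` at an element whose coefficients are constant in time.
Up to the factor `|T|^(1/q)` this is `(∑ ℓ, ℓ^(τ_q(s) q) |c_ℓ|^q)^(1/q)`. -/
noncomputable def besovNormConst (d : ℕ) (T : Set ℝ) (s q : ℝ) (c : ℕ → ℝ) : ℝ≥0∞ :=
  besovNorm d T s q q (fun ℓ _ => c ℓ)

/-- The spatiotemporal Besov process `u(x, t) = ∑ ℓ, γ_ℓ ξ_ℓ(t) φ_ℓ(x)`,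
`γ_ℓ = κ ℓ^(-τ_q(s))`, represented at `z = (x, t)` by the sequence of the terms of the series. -/
noncomputable def stbp {Ω : Type*} {d : ℕ} {X : Set (EuclideanSpace ℝ (Fin d))} {T : Set ℝ}
    (q s κ : ℝ) (φ : ℕ → X → ℝ) (ξ : ℕ → T → Ω → ℝ) (z : X × T) (ω : Ω) : ℕ → ℝ :=
  fun ℓ => κ * ((ℓ : ℝ) + 1) ^ (-tau d q s) * ξ ℓ z.2 ω * φ ℓ z.1

/-- Hölder condition on the spatial functions `φ_ℓ`, with `q`-summable constants. -/
def SpatialHolder {d : ℕ} {X : Set (EuclideanSpace ℝ (Fin d))} (q s s' α : ℝ)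
    (φ : ℕ → X → ℝ) : Prop :=
  (∃ L : ℕ → ℝ, (∀ ℓ, 0 ≤ L ℓ) ∧
    (∀ ℓ x x', |φ ℓ x - φ ℓ x'| ≤ L ℓ * ‖(x : EuclideanSpace ℝ (Fin d)) - x'‖ ^ (α + d / q)) ∧
    Summable (fun ℓ : ℕ => ((ℓ : ℝ) + 1) ^ ((s' - s) / d * q) * L ℓ ^ q)) ∧
  ∑' ℓ : ℕ, ENNReal.ofReal (((ℓ : ℝ) + 1) ^ ((s' - s) / d * q)) * (⨆ x, ‖φ ℓ x‖ₑ) ^ q ≠ ∞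

/-- Hölder condition on the temporal functions `ψ_j`, with `q`-summable constants. -/
def TemporalHolder (d : ℕ) {T : Set ℝ} (q α : ℝ) (lam : ℕ → ℝ) (ψ : ℕ → T → ℝ) : Prop :=
  ∃ L : ℕ → ℝ, (∀ j, 0 ≤ L j) ∧
    (∀ j t t', |ψ j t - ψ j t'| ≤ L j * |(t : ℝ) - t'| ^ (α + d / q)) ∧
    Summable (fun j => lam j ^ (q / 2) * L j ^ q)

/-- The path `w` belongs to `C^{0,β}(Z, B^{s,q}(Z))`, `Z = X × T ⊆ ℝ^d × ℝ` with the Euclidean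
distance: it is bounded and `β`-Hölder continuous in the norm of `B^{s,q}(Z)`. -/
def MemHolder {d : ℕ} {X : Set (EuclideanSpace ℝ (Fin d))} {T : Set ℝ} (β s q : ℝ)
    (w : X × T → ℕ → ℝ) : Prop :=
  (∃ M : ℝ, ∀ z, besovNormConst d T s q (w z) ≤ ENNReal.ofReal M) ∧
  ∃ K : ℝ, ∀ z z', besovNormConst d T s q (w z - w z') ≤ ENNReal.ofReal
    (K * ‖WithLp.toLp 2 ((z.1 : EuclideanSpace ℝ (Fin d)) - z'.1, (z.2 : ℝ) - z'.2)‖ ^ β)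

end STBP

/-!
The difference of two values of the process has the coefficients
`γ_ℓ ((ξ_ℓ(t) - ξ_ℓ(t')) φ_ℓ(x) + ξ_ℓ(t') (φ_ℓ(x) - φ_ℓ(x')))`. Once every `ξ_ℓ` is replaced by a
version that is bounded and `β`-Hölder in time with a random constant `H_ℓ`, and `A_ℓ` is a bound and
`β`-Hölder constant of `φ_ℓ`, the norm of the difference is at most a multiple of
`(∑ ℓ, ℓ^((s'-s)q/d) (H_ℓ A_ℓ)^q)^(1/q) |z - z'|^β` (`memHolder_stbp`). The deterministic series
`∑ ℓ, ℓ^((s'-s)q/d) A_ℓ^q` converges by the spatial condition, so the random one has finite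
expectation, and is almost surely finite, as soon as `E H_ℓ²` is bounded in `ℓ`. On the exceptional
null set the path is set to `0`. Thus Hölder continuity is only needed for real processes on a
bounded set of times.

That follows from chaining over dyadic nets, i.e. Kolmogorov's theorem (`exists_holder_version`).
Time is one-dimensional, so second moments of the increments suffice:
`E |ξ(t) - ξ(t')|² ≤ K |t - t'|^(2(α + d/q))` yields every Hölder exponent below `α + d/q - 1/2`,
which is at least `α` since `d / q ≥ 1/2`. The constant `K` is common to all `q-EP(0, C)`
processes, which makes `E H_ℓ²` bounded in `ℓ`.

The moment bound `exists_lintegral_sq_le` comes from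
`E |ξ(t) - ξ(t')|² ≤ m ∑ j, lam_j (ψ_j(t) - ψ_j(t'))²` and
`∑ j, lam_j L_j² < ∞`, a consequence of `∑ j, lam_j^(q/2) L_j^q < ∞` and `q ≤ 2`. For a process given by
its series, this is the additivity of the variance and Fatou's lemma. For a process given by its
finite-dimensional distributions, the law of `(ξ(t), ξ(t'))` is a linear image of the isotropic
`q-ED_2` law, so that the second moment is bounded by a multiple of `C(t,t) - 2 C(t,t') + C(t',t')`
(`lintegral_sq_qED_le`); the Mercer expansion of `C`, valid at every point because non-empty open
sets of times have positive measure, turns this into the same series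
(`IsEigenSystem.hasSum_mercer`).
-/

namespace STBP

open MeasureTheory ProbabilityTheory Filter
open scoped ENNReal Topology

/-! ### Second moments of the `q`-exponential distributions -/

/-- The radial second moment `E |w|²` of `w ~ q-ED_J(0, I)`. -/
noncomputable def qEDMoment (q : ℝ) (J : ℕ) : ℝ≥0∞ :=
  ∫⁻ w, ENNReal.ofReal (w ⬝ᵥ w) ∂(qED q (1 : Matrix (Fin J) (Fin J) ℝ))

lemma measurable_qEDDensity (q : ℝ) {J : ℕ} (A : Matrix (Fin J) (Fin J) ℝ) :
    Measurable (qEDDensity q A) := by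
  have h : Measurable fun v : Fin J → ℝ => v ⬝ᵥ (A⁻¹.mulVec v) := by
    apply Continuous.measurable
    fun_prop
  unfold qEDDensity
  fun_prop

lemma qEDDensity_one (q : ℝ) {J : ℕ} (w : Fin J → ℝ) :
    qEDDensity q 1 w = q / 2 * (2 * Real.pi) ^ (-(J : ℝ) / 2)
      * (w ⬝ᵥ w) ^ ((q / 2 - 1) * J / 2) * Real.exp (-((w ⬝ᵥ w) ^ (q / 2)) / 2) := by
  simp [qEDDensity]

lemma dotProduct_self_nonneg_real {J : ℕ} (w : Fin J → ℝ) : 0 ≤ w ⬝ᵥ w := by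
  simpa using dotProduct_star_self_nonneg w

lemma one_add_pow_six_le_exp {y : ℝ} (hy : 0 ≤ y) :
    (1 + y) ^ 6 ≤ 64 * 720 * Real.exp (1 / 2) * Real.exp (y / 2) := by
  have h := Real.pow_div_factorial_le_exp ((1 + y) / 2) (by positivity) 6
  rw [mul_assoc, ← Real.exp_add, show (1 : ℝ) / 2 + y / 2 = (1 + y) / 2 by ring]
  have : ((6 : ℕ).factorial : ℝ) = 720 := by norm_num [Nat.factorial]
  rw [this] at h
  have e : (1 + y) ^ 6 = 64 * 720 * (((1 + y) / 2) ^ 6 / 720) := by ring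
  rw [e]
  gcongr

/-- The radial profile of the second moment is `O((1 + r)⁻²)`; the bound `1 ≤ q` enters through
`√r ≤ 1 + r^(q/2)`. -/
lemma radial_profile_le {q a r : ℝ} (hq : 1 ≤ q) (ha : -1 ≤ a) (ha' : a ≤ 0) (hr : 0 ≤ r) :
    r * r ^ a * Real.exp (-(r ^ (q / 2)) / 2) ≤
      8 * (64 * 720 * Real.exp (1 / 2)) * ((1 + r) ^ 2)⁻¹ := by
  set y := r ^ (q / 2) with hy
  have hy0 : 0 ≤ y := by positivity
  have h1 : r * r ^ a ≤ 1 + r := by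
    rcases hr.eq_or_lt with rfl | hr'
    · simp
    · have hadd : r * r ^ a = r ^ (1 + a) := by rw [Real.rpow_add hr', Real.rpow_one]
      rw [hadd]
      calc r ^ (1 + a) ≤ (1 + r) ^ (1 + a) := by
            apply Real.rpow_le_rpow hr <;> linarith
        _ ≤ (1 + r) ^ (1 : ℝ) := by apply Real.rpow_le_rpow_of_exponent_le <;> linarith
        _ = 1 + r := Real.rpow_one _
  have h2 : 1 + r ≤ 2 * (1 + y) ^ 2 := by
    have : r ≤ (1 + y) ^ 2 := by
      rcases le_total r 1 with h | h
      · nlinarith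
      · have : r ^ (1 / 2 : ℝ) ≤ y := Real.rpow_le_rpow_of_exponent_le h (by linarith)
        have h3 : (r ^ (1 / 2 : ℝ)) ^ 2 = r := by
          rw [← Real.sqrt_eq_rpow, Real.sq_sqrt hr]
        have h4 : 0 ≤ r ^ (1 / 2 : ℝ) := by positivity
        nlinarith
    nlinarith
  have h3 : (1 + r) ^ 3 ≤ 8 * (64 * 720 * Real.exp (1 / 2)) * Real.exp (y / 2) := by
    calc (1 + r) ^ 3 ≤ (2 * (1 + y) ^ 2) ^ 3 := by gcongr
      _ = 8 * (1 + y) ^ 6 := by ring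
      _ ≤ _ := by
        rw [mul_assoc]
        exact mul_le_mul_of_nonneg_left (one_add_pow_six_le_exp hy0) (by norm_num)
  have h5 : Real.exp (-y / 2) = (Real.exp (y / 2))⁻¹ := by rw [← Real.exp_neg]; ring_nf
  rw [h5, ← div_eq_mul_inv, ← div_eq_mul_inv, div_le_div_iff₀ (Real.exp_pos _) (by positivity)]
  calc r * r ^ a * (1 + r) ^ 2 ≤ (1 + r) * (1 + r) ^ 2 := by gcongr
    _ = (1 + r) ^ 3 := by ring
    _ ≤ _ := h3

/-- In dimension at most two, `(1 + |w|²)⁻²` is dominated by the integrable product of the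
`(1 + w_i²)⁻¹`. -/
lemma qEDMoment_lt_top {q : ℝ} (hq1 : 1 ≤ q) (hq2 : q ≤ 2) {J : ℕ} (hJ : J ≤ 2) :
    qEDMoment q J < ∞ := by
  unfold qEDMoment qED
  rw [lintegral_withDensity_eq_lintegral_mul _ (by
    exact (measurable_qEDDensity q _).ennreal_ofReal) (by
    apply Measurable.ennreal_ofReal
    apply Continuous.measurable
    fun_prop)]
  set K := q / 2 * (2 * Real.pi) ^ (-(J : ℝ) / 2) * (8 * (64 * 720 * Real.exp (1 / 2))) with hK
  have hJ' : (J : ℝ) ≤ 2 := by exact_mod_cast hJ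
  have hint : Integrable (fun w : Fin J → ℝ => K * ∏ i, (1 + w i ^ 2)⁻¹) := by
    apply Integrable.const_mul
    exact Integrable.fintype_prod (f := fun _ (x : ℝ) => (1 + x ^ 2)⁻¹)
      (fun _ => integrable_inv_one_add_sq)
  refine lt_of_le_of_lt (lintegral_mono fun w => ?_) hint.lintegral_lt_top
  simp only [Pi.mul_apply]
  have hr := dotProduct_self_nonneg_real w
  rw [mul_comm, ← ENNReal.ofReal_mul hr]
  apply ENNReal.ofReal_le_ofReal
  rw [qEDDensity_one]
  set r := w ⬝ᵥ w with hrdef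
  have h1 := radial_profile_le (a := (q / 2 - 1) * J / 2) hq1
    (by nlinarith [Nat.cast_nonneg (α := ℝ) J]) (by nlinarith [Nat.cast_nonneg (α := ℝ) J]) hr
  have h2 : ((1 + r) ^ 2)⁻¹ ≤ ∏ i, (1 + w i ^ 2)⁻¹ := by
    rw [Finset.prod_inv_distrib]
    apply inv_anti₀ (by positivity)
    calc ∏ i, (1 + w i ^ 2) ≤ ∏ _i : Fin J, (1 + r) := by
          apply Finset.prod_le_prod (fun _ _ => by positivity)
          intro i _
          have : w i ^ 2 ≤ ∑ j, w j * w j := by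
            rw [pow_two]
            exact Finset.single_le_sum (f := fun j => w j * w j)
              (fun j _ => mul_self_nonneg _) (Finset.mem_univ i)
          rw [hrdef, dotProduct]
          linarith
      _ = (1 + r) ^ J := by simp
      _ ≤ (1 + r) ^ 2 := pow_le_pow_right₀ (by linarith) hJ
  have hc : 0 ≤ q / 2 * (2 * Real.pi) ^ (-(J : ℝ) / 2) := by positivity
  calc _ = q / 2 * (2 * Real.pi) ^ (-(J : ℝ) / 2) *
        (r * r ^ ((q / 2 - 1) * J / 2) * Real.exp (-(r ^ (q / 2)) / 2)) := by ring
    _ ≤ q / 2 * (2 * Real.pi) ^ (-(J : ℝ) / 2) *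
        (8 * (64 * 720 * Real.exp (1 / 2)) * ∏ i, (1 + w i ^ 2)⁻¹) := by
      refine mul_le_mul_of_nonneg_left (h1.trans ?_) hc
      gcongr
    _ = _ := by rw [hK]; ring

/-- For invertible `A` the distribution `q-ED_J(0, A Aᵀ)` is the law of `A w`,
`w ~ q-ED_J(0, I)`. -/
lemma qED_mul_transpose (q : ℝ) {J : ℕ} {A : Matrix (Fin J) (Fin J) ℝ} (hA : A.det ≠ 0) :
    qED q (A * A.transpose) = (qED q (1 : Matrix (Fin J) (Fin J) ℝ)).map A.mulVec := by
  have hmeas : Measurable A.mulVec := by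
    apply Continuous.measurable; fun_prop
  have hunit : IsUnit A.det := isUnit_iff_ne_zero.mpr hA
  have hvol : (volume : Measure (Fin J → ℝ)) =
      ENNReal.ofReal |A.det| • (volume : Measure (Fin J → ℝ)).map A.mulVec := by
    have := Real.map_matrix_volume_pi_eq_smul_volume_pi hA
    have e : (⇑(Matrix.toLin' A) : (Fin J → ℝ) → Fin J → ℝ) = A.mulVec := by
      ext v; simp [Matrix.toLin'_apply]
    rw [e] at this
    rw [this, smul_smul, ← ENNReal.ofReal_mul (abs_nonneg _), ← abs_mul,
      mul_inv_cancel₀ hA, abs_one, ENNReal.ofReal_one, one_smul]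
  have hdens : ∀ w, |A.det| * qEDDensity q (A * A.transpose) (A.mulVec w) =
      qEDDensity q 1 w := by
    intro w
    have hr : A.mulVec w ⬝ᵥ ((A * A.transpose)⁻¹.mulVec (A.mulVec w)) = w ⬝ᵥ w := by
      rw [Matrix.mul_inv_rev, Matrix.mulVec_mulVec, Matrix.mul_assoc,
        Matrix.nonsing_inv_mul _ hunit, Matrix.mul_one, Matrix.dotProduct_mulVec,
        ← Matrix.transpose_nonsing_inv, Matrix.vecMul_transpose, Matrix.mulVec_mulVec,
        Matrix.nonsing_inv_mul _ hunit, Matrix.one_mulVec]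
    have hd : |A.det| * (A * A.transpose).det ^ (-(1 : ℝ) / 2) = 1 := by
      have h0 : 0 < |A.det| := abs_pos.mpr hA
      rw [Matrix.det_mul, Matrix.det_transpose, ← abs_mul_abs_self A.det]
      rw [show (-(1 : ℝ) / 2) = -(1 / 2) by ring, Real.rpow_neg (by positivity),
        ← Real.sqrt_eq_rpow, Real.sqrt_mul_self h0.le, mul_inv_cancel₀ h0.ne']
    rw [qEDDensity_one, qEDDensity, hr]
    calc _ = (|A.det| * (A * A.transpose).det ^ (-(1 : ℝ) / 2)) *
          (q / 2 * (2 * Real.pi) ^ (-(J : ℝ) / 2) * (w ⬝ᵥ w) ^ ((q / 2 - 1) * J / 2)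
            * Real.exp (-((w ⬝ᵥ w) ^ (q / 2)) / 2)) := by ring
      _ = _ := by rw [hd, one_mul]
  ext s hs
  rw [Measure.map_apply hmeas hs, qED, qED, withDensity_apply _ hs,
    withDensity_apply _ (hmeas hs)]
  conv_lhs => rw [hvol]
  rw [Measure.restrict_smul, lintegral_smul_measure, setLIntegral_map hs
    (measurable_qEDDensity q _).ennreal_ofReal hmeas, smul_eq_mul,
    ← lintegral_const_mul' _ _ ENNReal.ofReal_ne_top]
  refine lintegral_congr fun w => ?_
  rw [← ENNReal.ofReal_mul (abs_nonneg _), hdens]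

/-- A linear functional `e` of a `q-ED_J(0, A)` vector has second moment at most a multiple,
independent of `A`, of `eᵀ A e`. For singular `A` the density vanishes identically, as
`0 ^ (-1/2) = 0`. -/
lemma lintegral_sq_qED_le (q : ℝ) {J : ℕ} {A : Matrix (Fin J) (Fin J) ℝ} (hA : A.PosSemidef)
    (e : Fin J → ℝ) :
    ∫⁻ v, ENNReal.ofReal ((e ⬝ᵥ v) ^ 2) ∂(qED q A) ≤
      ENNReal.ofReal (e ⬝ᵥ A.mulVec e) * qEDMoment q J := by
  by_cases hdet : A.det = 0
  · have : qED q A = 0 := by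
      have h0 : ∀ v, qEDDensity q A v = 0 := by
        intro v
        simp [qEDDensity, hdet, Real.zero_rpow (show (-(1 : ℝ) / 2) ≠ 0 by norm_num)]
      simp [qED, h0]
    simp [this]
  · obtain ⟨B, hBt, hBB⟩ : ∃ B : Matrix (Fin J) (Fin J) ℝ, B.transpose = B ∧ B * B = A := by
      open scoped MatrixOrder in
      have h0 : 0 ≤ A := Matrix.nonneg_iff_posSemidef.mpr hA
      open scoped MatrixOrder in
      refine ⟨CFC.sqrt A, ?_, CFC.sqrt_mul_sqrt_self A⟩
      have h1 : (CFC.sqrt A).IsHermitian :=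
        (Matrix.nonneg_iff_posSemidef.mp (CFC.sqrt_nonneg A)).1
      simpa [Matrix.IsHermitian] using h1
    have hBdet : B.det ≠ 0 := by
      intro h
      apply hdet
      rw [← hBB, Matrix.det_mul, h, zero_mul]
    have hAB : A = B * B.transpose := by rw [hBt, hBB]
    have hmeas : Measurable B.mulVec := by
      apply Continuous.measurable; fun_prop
    rw [hAB, qED_mul_transpose q hBdet, lintegral_map (by
      apply Measurable.ennreal_ofReal
      apply Continuous.measurable
      fun_prop) hmeas, qEDMoment, ← lintegral_const_mul _ (by
      apply Measurable.ennreal_ofReal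
      apply Continuous.measurable
      fun_prop)]
    refine lintegral_mono fun w => ?_
    have hq : e ⬝ᵥ (B * B.transpose).mulVec e = B.transpose.mulVec e ⬝ᵥ B.transpose.mulVec e := by
      rw [← Matrix.mulVec_mulVec, Matrix.dotProduct_mulVec, ← Matrix.mulVec_transpose]
    rw [hq, ← ENNReal.ofReal_mul (dotProduct_self_nonneg_real _)]
    apply ENNReal.ofReal_le_ofReal
    rw [Matrix.dotProduct_mulVec, ← Matrix.mulVec_transpose]
    have := Finset.sum_mul_sq_le_sq_mul_sq Finset.univ (B.transpose.mulVec e) w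
    simpa [dotProduct, pow_two] using this

/-- `q-ED_1(0, 1)` is symmetric, so that `q-ED(0, lam)` is centred. -/
lemma integral_qED1 (q lam : ℝ) : ∫ x, x ∂(qED1 q lam) = 0 := by
  have hneg : (qED q (1 : Matrix (Fin 1) (Fin 1) ℝ)).map (fun v => -v) = qED q 1 := by
    ext s hs
    rw [Measure.map_apply measurable_neg hs, qED, withDensity_apply _ hs,
      withDensity_apply _ (measurable_neg hs)]
    have := (Measure.measurePreserving_neg
      (volume : Measure (Fin 1 → ℝ))).setLIntegral_comp_preimage hs
      (measurable_qEDDensity q 1).ennreal_ofReal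
    rw [← this]
    refine lintegral_congr fun w => ?_
    simp [qEDDensity_one]
  have hm : Measurable fun v : Fin 1 → ℝ => Real.sqrt lam * v 0 := by fun_prop
  rw [qED1, integral_map hm.aemeasurable (f := fun x => x) aestronglyMeasurable_id]
  have h2 : ∫ v, Real.sqrt lam * v 0 ∂(qED q (1 : Matrix (Fin 1) (Fin 1) ℝ)) =
      ∫ v, Real.sqrt lam * (-v) 0 ∂(qED q (1 : Matrix (Fin 1) (Fin 1) ℝ)) := by
    conv_lhs => rw [← hneg]
    rw [integral_map measurable_neg.aemeasurable hm.aestronglyMeasurable]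
  simp only [Pi.neg_apply, mul_neg, integral_neg] at h2
  linarith

lemma lintegral_sq_qED1 (q : ℝ) {lam : ℝ} (hlam : 0 ≤ lam) :
    ∫⁻ x, ENNReal.ofReal (x ^ 2) ∂(qED1 q lam) = ENNReal.ofReal lam * qEDMoment q 1 := by
  rw [qED1, lintegral_map (by fun_prop) (by fun_prop), qEDMoment,
    ← lintegral_const_mul _ (by
      apply Measurable.ennreal_ofReal
      apply Continuous.measurable
      fun_prop)]
  refine lintegral_congr fun v => ?_
  rw [← ENNReal.ofReal_mul hlam, mul_pow, Real.sq_sqrt hlam]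
  simp [dotProduct, pow_two]

/-! ### Mercer expansion of the covariance kernel -/

lemma isFiniteMeasure_timeMeasure {T : Set ℝ} (hTmeas : MeasurableSet T)
    (hTbdd : Bornology.IsBounded T) : IsFiniteMeasure (timeMeasure T) := by
  constructor
  rw [timeMeasure, (MeasurableEmbedding.subtype_coe hTmeas).comap_apply]
  simpa using hTbdd.measure_lt_top

/-- On a space where open sets have positive measure, a continuous kernel is everywhere equal to
its eigenfunction expansion as soon as the latter converges normally: the two sides are continuous,
and for almost every `t` their difference in `t'` is orthogonal to all eigenfunctions. -/
lemma IsEigenSystem.hasSum_mercer {T : Set ℝ} [(timeMeasure T).IsOpenPosMeasure]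
    [IsFiniteMeasure (timeMeasure T)] {C : T → T → ℝ} {lam : ℕ → ℝ} {ψ : ℕ → T → ℝ}
    (hC : IsEigenSystem C lam ψ) {b : ℕ → ℝ} (hψ : ∀ j, Continuous (ψ j))
    (hb : ∀ j t, |ψ j t| ≤ b j) (hsum : Summable fun j => lam j * b j ^ 2) (t t' : T) :
    HasSum (fun j => lam j * (ψ j t * ψ j t')) (C t t') := by
  set μ := timeMeasure T with hμ
  have hterm : ∀ j t t', ‖lam j * (ψ j t * ψ j t')‖ ≤ lam j * b j ^ 2 := by
    intro j t t'
    rw [norm_mul, Real.norm_of_nonneg (hC.eigenvalue_nonneg j), norm_mul, pow_two]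
    have h0 := (abs_nonneg _).trans (hb j t)
    exact mul_le_mul_of_nonneg_left (mul_le_mul (hb j t) (hb j t') (abs_nonneg _) h0)
      (hC.eigenvalue_nonneg j)
  have hsummable : ∀ t t', Summable fun j => lam j * (ψ j t * ψ j t') := fun t t' =>
    Summable.of_norm_bounded hsum (fun j => hterm j t t')
  set K : T → T → ℝ := fun t t' => ∑' j, lam j * (ψ j t * ψ j t') with hK
  have hKcont : Continuous (Function.uncurry K) := by
    refine continuous_tsum (fun j => ?_) hsum (fun j p => hterm j p.1 p.2)
    have := hψ j
    fun_prop
  have hKr : ∀ t, Continuous (K t) := fun t => hKcont.comp (Continuous.prodMk_right t)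
  have hCr : ∀ t, Continuous (C t) := fun t => hC.continuous.comp (Continuous.prodMk_right t)
  have hKl : ∀ t', Continuous fun t => K t t' := fun t' => hKcont.comp (Continuous.prodMk_left t')
  have hCl : ∀ t', Continuous fun t => C t t' := fun t' =>
    hC.continuous.comp (Continuous.prodMk_left t')
  have hKint : ∀ t j, ∫ t', K t t' * ψ j t' ∂μ = lam j * ψ j t := by
    intro t j
    have hle : ∀ i t', ‖lam i * (ψ i t * ψ i t') * ψ j t'‖ ≤ lam i * b i ^ 2 * b j := by
      intro i t'
      rw [norm_mul]
      exact mul_le_mul (hterm i t t') (hb j t') (abs_nonneg _)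
        ((norm_nonneg _).trans (hterm i t t'))
    have hmeas : ∀ i, AEStronglyMeasurable (fun t' => lam i * (ψ i t * ψ i t') * ψ j t') μ := by
      intro i
      have h1 := hψ i
      have h2 := hψ j
      exact Continuous.aestronglyMeasurable (by fun_prop)
    have h := hasSum_integral_of_summable_integral_norm (μ := μ)
      (F := fun i t' => lam i * (ψ i t * ψ i t') * ψ j t')
      (fun i => Integrable.of_bound (hmeas i) _ (Eventually.of_forall (hle i)))
      (by
        refine Summable.of_nonneg_of_le (fun i => integral_nonneg fun _ => norm_nonneg _)
          (fun i => ?_) (hsum.mul_right (b j * μ.real Set.univ))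
        calc ∫ t', ‖lam i * (ψ i t * ψ i t') * ψ j t'‖ ∂μ
            ≤ ∫ _t', lam i * b i ^ 2 * b j ∂μ :=
              integral_mono_of_nonneg (Eventually.of_forall fun _ => norm_nonneg _)
                (integrable_const _) (Eventually.of_forall (hle i))
          _ = _ := by rw [integral_const, smul_eq_mul]; ring)
    have e1 : ∀ i, ∫ t', lam i * (ψ i t * ψ i t') * ψ j t' ∂μ =
        if i = j then lam j * ψ j t else 0 := by
      intro i
      have : ∀ t', lam i * (ψ i t * ψ i t') * ψ j t' = lam i * ψ i t * (ψ i t' * ψ j t') :=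
        fun t' => by ring
      simp_rw [this]
      rw [integral_const_mul, hC.orthonormal i j]
      split_ifs with hij
      · rw [hij, mul_one]
      · rw [mul_zero]
    simp_rw [e1] at h
    have e2 : ∀ t', ∑' i, lam i * (ψ i t * ψ i t') * ψ j t' = K t t' * ψ j t' := fun t' =>
      tsum_mul_right
    simp_rw [e2] at h
    exact h.unique (hasSum_ite_eq j _)
  have hCL2 : ∀ᵐ t ∂μ, MemLp (C t) 2 μ := by
    have h1 := hC.hilbertSchmidt.integrable_sq
    filter_upwards [h1.prod_right_ae] with t ht
    exact (memLp_two_iff_integrable_sq (hCr t).aestronglyMeasurable).mpr ht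
  have hKL2 : ∀ t, MemLp (K t) 2 μ := fun t =>
    MemLp.of_bound (hKr t).aestronglyMeasurable (∑' j, lam j * b j ^ 2)
      (Eventually.of_forall fun t' => tsum_of_norm_bounded hsum.hasSum fun j => hterm j t t')
  have hrow : ∀ᵐ t ∂μ, C t = K t := by
    filter_upwards [hCL2, ae_all_iff.mpr hC.eigen] with t h1 h2
    have h3 := hC.complete (fun t' => C t t' - K t t') (h1.sub (hKL2 t)) (fun j => by
      simp_rw [sub_mul]
      have h3 : Integrable (fun t' => C t t' * ψ j t') μ := h1.integrable_mul (hC.memLp j)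
      have h4 : Integrable (fun t' => K t t' * ψ j t') μ := (hKL2 t).integrable_mul (hC.memLp j)
      rw [integral_sub h3 h4, h2 j, hKint t j, sub_self])
    have h4 : C t =ᵐ[μ] K t := by
      filter_upwards [h3] with t' ht'
      simpa [sub_eq_zero] using ht'
    exact ((hCr t).ae_eq_iff_eq μ (hKr t)).mp h4
  have hall : (fun t => C t t') = fun t => K t t' := by
    refine ((hCl t').ae_eq_iff_eq μ (hKl t')).mp ?_
    filter_upwards [hrow] with t ht
    rw [ht]
  rw [show C t t' = K t t' from congrFun hall t]
  exact (hsummable t t').hasSum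

lemma summable_rpow_of_one_le {f : ℕ → ℝ} (hf : ∀ j, 0 ≤ f j) (hs : Summable f) {p : ℝ}
    (hp : 1 ≤ p) : Summable fun j => f j ^ p := by
  have h1 : ∀ᶠ j in atTop, f j ≤ 1 :=
    (hs.tendsto_atTop_zero.eventually_lt_const one_pos).mono fun _ h => h.le
  refine Summable.of_norm_bounded_eventually_nat hs ?_
  filter_upwards [h1] with j hj
  rw [Real.norm_of_nonneg (Real.rpow_nonneg (hf j) p)]
  exact Real.rpow_le_self_of_le_one (hf j) hj hp

/-- A normalized eigenfunction is somewhere at most `|T|^(-1/2)` in absolute value. -/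
lemma IsEigenSystem.exists_abs_le {T : Set ℝ} [IsFiniteMeasure (timeMeasure T)]
    {C : T → T → ℝ} {lam : ℕ → ℝ} {ψ : ℕ → T → ℝ} (hC : IsEigenSystem C lam ψ) (j : ℕ) :
    ∃ t, |ψ j t| ≤ Real.sqrt ((timeMeasure T).real Set.univ)⁻¹ := by
  have h1 := hC.orthonormal j j
  rw [if_pos rfl] at h1
  have hne : timeMeasure T ≠ 0 := by
    intro h
    simp [h] at h1
  have hint : Integrable (fun t => ψ j t * ψ j t) (timeMeasure T) :=
    (hC.memLp j).integrable_mul (hC.memLp j)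
  have : NeZero (timeMeasure T) := ⟨hne⟩
  obtain ⟨t, ht⟩ := exists_le_average hne hint
  refine ⟨t, ?_⟩
  rw [average_eq, h1, smul_eq_mul, mul_one] at ht
  apply Real.abs_le_sqrt
  rwa [pow_two]

/-- The temporal Hölder condition makes the eigenfunctions continuous and bounded, with
`∑ lam_j ‖ψ_j‖_∞² < ∞` and `∑ lam_j L_j² < ∞`; here `q ≤ 2` is used. -/
lemma TemporalHolder.exists_bounds {T : Set ℝ} (hTbdd : Bornology.IsBounded T)
    [IsFiniteMeasure (timeMeasure T)] {d : ℕ} {q α : ℝ}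
    (hq1 : 1 ≤ q) (hq2 : q ≤ 2) (hα : 0 < α) {C : T → T → ℝ} {lam : ℕ → ℝ} {ψ : ℕ → T → ℝ}
    (hC : IsEigenSystem C lam ψ) (hlam : Summable fun j => lam j ^ (q / 2))
    (hψ : TemporalHolder d q α lam ψ) :
    (∀ j, Continuous (ψ j)) ∧
    (∃ b : ℕ → ℝ, (∀ j t, |ψ j t| ≤ b j) ∧ Summable fun j => lam j * b j ^ 2) ∧
    (∃ L : ℕ → ℝ, (∀ j, 0 ≤ L j) ∧
      (∀ j t t', |ψ j t - ψ j t'| ≤ L j * |(t : ℝ) - t'| ^ (α + d / q)) ∧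
      Summable fun j => lam j * L j ^ 2) := by
  obtain ⟨L, hL0, hL, hLs⟩ := hψ
  have hq0 : 0 < q := by linarith
  have hγ : 0 < α + d / q := by positivity
  have hp : 1 ≤ 2 / q := by rw [le_div_iff₀ hq0]; linarith
  have hl0 := hC.eigenvalue_nonneg
  have hlam1 : Summable lam := by
    have := summable_rpow_of_one_le (fun j => Real.rpow_nonneg (hl0 j) _) hlam hp
    refine this.congr fun j => ?_
    rw [← Real.rpow_mul (hl0 j), show q / 2 * (2 / q) = 1 by field_simp, Real.rpow_one]
  have hLs2 : Summable fun j => lam j * L j ^ 2 := by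
    have := summable_rpow_of_one_le
      (fun j => mul_nonneg (Real.rpow_nonneg (hl0 j) _) (Real.rpow_nonneg (hL0 j) q)) hLs hp
    refine this.congr fun j => ?_
    rw [Real.mul_rpow (Real.rpow_nonneg (hl0 j) _) (Real.rpow_nonneg (hL0 j) q),
      ← Real.rpow_mul (hl0 j), ← Real.rpow_mul (hL0 j), show q / 2 * (2 / q) = 1 by field_simp,
      show q * (2 / q) = (2 : ℕ) by field_simp; norm_num, Real.rpow_one, Real.rpow_natCast]
  refine ⟨fun j => ?_, ?_, L, hL0, hL, hLs2⟩
  · rw [continuous_iff_continuousAt]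
    intro t
    rw [ContinuousAt, tendsto_iff_norm_sub_tendsto_zero]
    have h0 : Tendsto (fun s : T => L j * |(s : ℝ) - t| ^ (α + d / q)) (𝓝 t) (𝓝 0) := by
      have hc : Continuous fun s : T => L j * |(s : ℝ) - t| ^ (α + d / q) := by
        have : Continuous fun s : T => |(s : ℝ) - t| := by fun_prop
        exact continuous_const.mul (this.rpow_const fun _ => Or.inr hγ.le)
      have := hc.tendsto t
      simpa [Real.zero_rpow hγ.ne'] using this
    exact squeeze_zero (fun _ => norm_nonneg _) (fun s => hL j s t) h0
  · set M := Real.sqrt ((timeMeasure T).real Set.univ)⁻¹ with hM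
    set D := Metric.diam T ^ (α + d / q) with hD
    refine ⟨fun j => M + L j * D, fun j t => ?_, ?_⟩
    · obtain ⟨t₁, ht₁⟩ := hC.exists_abs_le j
      have h1 : |(t : ℝ) - t₁| ^ (α + d / q) ≤ D := by
        apply Real.rpow_le_rpow (abs_nonneg _) _ hγ.le
        rw [← Real.dist_eq]
        exact Metric.dist_le_diam_of_mem hTbdd t.2 t₁.2
      calc |ψ j t| = |ψ j t₁ + (ψ j t - ψ j t₁)| := by ring_nf
        _ ≤ |ψ j t₁| + |ψ j t - ψ j t₁| := abs_add_le _ _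
        _ ≤ M + L j * D :=
          add_le_add ht₁ ((hL j t t₁).trans (mul_le_mul_of_nonneg_left h1 (hL0 j)))
    · refine Summable.of_nonneg_of_le (fun j => mul_nonneg (hl0 j) (sq_nonneg _)) (fun j => ?_)
        ((hlam1.mul_left (2 * M ^ 2)).add (hLs2.mul_left (2 * D ^ 2)))
      nlinarith [mul_nonneg (hl0 j) (sq_nonneg (M - L j * D))]

/-! ### Second moments of `q`-exponential processes -/

lemma lintegral_sq_sum {Ω : Type*} [MeasurableSpace Ω] {P : Measure Ω}
    [IsProbabilityMeasure P] {q : ℝ} (hm : qEDMoment q 1 < ∞) {lam : ℕ → ℝ}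
    (hlam : ∀ j, 0 ≤ lam j) {a : ℕ → Ω → ℝ} (ha : ∀ j, Measurable (a j)) (hind : iIndepFun a P)
    (hlaw : ∀ j, P.map (a j) = qED1 q (lam j)) (b : ℕ → ℝ) (s : Finset ℕ) :
    ∫⁻ ω, ENNReal.ofReal ((∑ j ∈ s, a j ω * b j) ^ 2) ∂P =
      (∑ j ∈ s, ENNReal.ofReal (lam j * b j ^ 2)) * qEDMoment q 1 := by
  have hsq : ∀ j, ∫⁻ ω, ENNReal.ofReal (a j ω ^ 2) ∂P =
      ENNReal.ofReal (lam j) * qEDMoment q 1 := by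
    intro j
    rw [← lintegral_sq_qED1 q (hlam j), ← hlaw j, lintegral_map (by fun_prop) (ha j)]
  have hL2 : ∀ j, MemLp (a j) 2 P := by
    intro j
    rw [memLp_two_iff_integrable_sq (ha j).aestronglyMeasurable]
    refine ⟨by have := ha j; fun_prop, ?_⟩
    rw [hasFiniteIntegral_iff_ofReal (Eventually.of_forall fun ω => sq_nonneg _), hsq j]
    exact ENNReal.mul_lt_top ENNReal.ofReal_lt_top hm
  have hmean : ∀ j, ∫ ω, a j ω ∂P = 0 := by
    intro j
    rw [← integral_qED1 q (lam j), ← hlaw j,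
      integral_map (ha j).aemeasurable (f := fun x => x) aestronglyMeasurable_id]
  set X : ℕ → Ω → ℝ := fun j ω => a j ω * b j with hX
  have hXL2 : ∀ j, MemLp (X j) 2 P := fun j => (hL2 j).mul_const (b j)
  have hXmean : ∀ j, ∫ ω, X j ω ∂P = 0 := by
    intro j
    simp only [hX]
    rw [integral_mul_const, hmean, zero_mul]
  have hXind : iIndepFun X P := hind.comp (fun j x => x * b j) (fun j => by fun_prop)
  have hvar := IndepFun.variance_sum (s := s) (fun i _ => hXL2 i)
    (fun i _ j _ hij => hXind.indepFun hij)
  have hsumL2 : MemLp (∑ j ∈ s, X j) 2 P := memLp_finsetSum' s fun i _ => hXL2 i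
  have hsummean : ∫ ω, (∑ j ∈ s, X j) ω ∂P = 0 := by
    simp only [Finset.sum_apply]
    rw [integral_finsetSum _ fun i _ => (hXL2 i).integrable one_le_two]
    simp [hXmean]
  have hvar0 : ∀ Y : Ω → ℝ, MemLp Y 2 P → ∫ ω, Y ω ∂P = 0 →
      ENNReal.ofReal (Var[Y; P]) = ∫⁻ ω, ENNReal.ofReal (Y ω ^ 2) ∂P := by
    intro Y hY h0
    rw [variance_of_integral_eq_zero hY.aestronglyMeasurable.aemeasurable h0,
      ofReal_integral_eq_lintegral_ofReal hY.integrable_sq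
        (Eventually.of_forall fun ω => sq_nonneg _)]
  have h1 := hvar0 _ hsumL2 hsummean
  simp only [Finset.sum_apply] at h1
  rw [← h1, hvar, ENNReal.ofReal_sum_of_nonneg fun i _ => variance_nonneg _ _, Finset.sum_mul]
  refine Finset.sum_congr rfl fun j _ => ?_
  rw [hvar0 _ (hXL2 j) (hXmean j)]
  simp only [hX, mul_pow]
  simp_rw [ENNReal.ofReal_mul' (sq_nonneg (b j))]
  rw [lintegral_mul_const' _ _ ENNReal.ofReal_ne_top, hsq]
  ring

/-- The second-moment identity for partial sums passes, as an inequality, to their almost sure limit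
along a subsequence. -/
lemma lintegral_sq_lim_le {Ω : Type*} [MeasurableSpace Ω] {P : Measure Ω}
    [IsProbabilityMeasure P] {q : ℝ} (hm : qEDMoment q 1 < ∞) {lam : ℕ → ℝ}
    (hlam : ∀ j, 0 ≤ lam j) {a : ℕ → Ω → ℝ} (ha : ∀ j, Measurable (a j)) (hind : iIndepFun a P)
    (hlaw : ∀ j, P.map (a j) = qED1 q (lam j)) (b : ℕ → ℝ) (hb : Summable fun j => lam j * b j ^ 2)
    (n : ℕ → ℕ) {X : Ω → ℝ}
    (hX : ∀ᵐ ω ∂P, Tendsto (fun i => ∑ j ∈ Finset.range (n i), a j ω * b j) atTop (𝓝 (X ω))) :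
    ∫⁻ ω, ENNReal.ofReal (X ω ^ 2) ∂P ≤
      ENNReal.ofReal (∑' j, lam j * b j ^ 2) * qEDMoment q 1 := by
  have hb0 : ∀ j, 0 ≤ lam j * b j ^ 2 := fun j => mul_nonneg (hlam j) (sq_nonneg _)
  set S : ℕ → Ω → ℝ≥0∞ := fun i ω =>
    ENNReal.ofReal ((∑ j ∈ Finset.range (n i), a j ω * b j) ^ 2) with hS
  have hSm : ∀ i, Measurable (S i) := fun i => by fun_prop
  calc ∫⁻ ω, ENNReal.ofReal (X ω ^ 2) ∂P = ∫⁻ ω, liminf (fun i => S i ω) atTop ∂P := by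
        refine lintegral_congr_ae ?_
        filter_upwards [hX] with ω hω
        exact ((ENNReal.tendsto_ofReal (hω.pow 2)).liminf_eq).symm
    _ ≤ liminf (fun i => ∫⁻ ω, S i ω ∂P) atTop := lintegral_liminf_le hSm
    _ ≤ ENNReal.ofReal (∑' j, lam j * b j ^ 2) * qEDMoment q 1 := by
        refine liminf_le_of_frequently_le' (Frequently.of_forall fun i => ?_)
        simp only [hS]
        rw [lintegral_sq_sum hm hlam ha hind hlaw, ← ENNReal.ofReal_sum_of_nonneg
          fun j _ => hb0 j]
        gcongr
        exact hb.sum_le_tsum _ fun j _ => hb0 j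

lemma HasQEDSeries.lintegral_sq_le {Ω : Type*} [MeasurableSpace Ω] {P : Measure Ω}
    [IsProbabilityMeasure P] {T : Set ℝ} {q : ℝ} (hm : qEDMoment q 1 < ∞) {lam : ℕ → ℝ}
    (hlam : ∀ j, 0 ≤ lam j) {ψ : ℕ → T → ℝ} {ξ : T → Ω → ℝ} (h : HasQEDSeries P q lam ψ ξ)
    (t : T) (hs : Summable fun j => lam j * ψ j t ^ 2) :
    ∫⁻ ω, ENNReal.ofReal (ξ t ω ^ 2) ∂P ≤
      ENNReal.ofReal (∑' j, lam j * ψ j t ^ 2) * qEDMoment q 1 := by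
  obtain ⟨a, ha, hind, hlaw, hconv⟩ := h
  obtain ⟨n, -, hn⟩ := (hconv t).exists_seq_tendsto_ae
  exact lintegral_sq_lim_le hm hlam ha hind hlaw (fun j => ψ j t) hs n hn

lemma HasQEDSeries.lintegral_sq_sub_le {Ω : Type*} [MeasurableSpace Ω] {P : Measure Ω}
    [IsProbabilityMeasure P] {T : Set ℝ} {q : ℝ} (hm : qEDMoment q 1 < ∞) {lam : ℕ → ℝ}
    (hlam : ∀ j, 0 ≤ lam j) {ψ : ℕ → T → ℝ} {ξ : T → Ω → ℝ} (h : HasQEDSeries P q lam ψ ξ)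
    (t t' : T) (hs : Summable fun j => lam j * (ψ j t - ψ j t') ^ 2) :
    ∫⁻ ω, ENNReal.ofReal ((ξ t ω - ξ t' ω) ^ 2) ∂P ≤
      ENNReal.ofReal (∑' j, lam j * (ψ j t - ψ j t') ^ 2) * qEDMoment q 1 := by
  obtain ⟨a, ha, hind, hlaw, hconv⟩ := h
  obtain ⟨n, hn, hnt⟩ := (hconv t).exists_seq_tendsto_ae
  -- a common subsequence for both times
  obtain ⟨k, hk, hkt⟩ := ((hconv t').comp hn.tendsto_atTop).exists_seq_tendsto_ae
  refine lintegral_sq_lim_le hm hlam ha hind hlaw (fun j => ψ j t - ψ j t') hs (n ∘ k) ?_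
  filter_upwards [hnt, hkt] with ω h1 h2
  have := (h1.comp hk.tendsto_atTop).sub h2
  simpa [Function.comp_def, ← Finset.sum_sub_distrib, mul_sub] using this

lemma IsEigenSystem.posSemidef {T : Set ℝ} {C : T → T → ℝ} {lam : ℕ → ℝ} {ψ : ℕ → T → ℝ}
    (hC : IsEigenSystem C lam ψ) {J : ℕ} (t : Fin J → T) :
    (Matrix.of fun i j => C (t i) (t j)).PosSemidef := by
  refine Matrix.PosSemidef.of_dotProduct_mulVec_nonneg ?_ fun c => ?_
  · ext i j
    simp [Matrix.conjTranspose_apply, hC.symm (t j) (t i)]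
  · have := hC.nonneg J t c
    simp only [dotProduct, Matrix.mulVec, Matrix.of_apply, star_trivial, Finset.mul_sum]
    refine this.trans_eq ?_
    refine Finset.sum_congr rfl fun i _ => Finset.sum_congr rfl fun j _ => by ring

lemma HasQEDMarginals.lintegral_sq_le {Ω : Type*} [MeasurableSpace Ω] {P : Measure Ω}
    {T : Set ℝ} {q : ℝ} {C : T → T → ℝ} {lam : ℕ → ℝ} {ψ : ℕ → T → ℝ}
    (hC : IsEigenSystem C lam ψ) {ξ : T → Ω → ℝ} (hξ : ∀ t, Measurable (ξ t))
    (h : HasQEDMarginals P q C ξ) (t : T) :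
    ∫⁻ ω, ENNReal.ofReal (ξ t ω ^ 2) ∂P ≤ ENNReal.ofReal (C t t) * qEDMoment q 1 := by
  have h1 := lintegral_sq_qED_le q (hC.posSemidef ![t]) ![1]
  rw [← h 1 ![t] one_pos (Function.injective_of_subsingleton _), lintegral_map
    (Measurable.ennreal_ofReal (Continuous.measurable (by fun_prop)))
    (measurable_pi_lambda _ fun i => hξ _)] at h1
  simpa [dotProduct, Matrix.mulVec] using h1

lemma HasQEDMarginals.lintegral_sq_sub_le {Ω : Type*} [MeasurableSpace Ω] {P : Measure Ω}
    {T : Set ℝ} {q : ℝ} {C : T → T → ℝ} {lam : ℕ → ℝ} {ψ : ℕ → T → ℝ}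
    (hC : IsEigenSystem C lam ψ) {ξ : T → Ω → ℝ} (hξ : ∀ t, Measurable (ξ t))
    (h : HasQEDMarginals P q C ξ) (t t' : T) :
    ∫⁻ ω, ENNReal.ofReal ((ξ t ω - ξ t' ω) ^ 2) ∂P ≤
      ENNReal.ofReal (C t t - 2 * C t t' + C t' t') * qEDMoment q 2 := by
  rcases eq_or_ne t t' with rfl | hne
  · simp
  have h1 := lintegral_sq_qED_le q (hC.posSemidef ![t, t']) ![1, -1]
  rw [← h 2 ![t, t'] two_pos (by
    intro i j hij
    fin_cases i <;> fin_cases j <;> simp_all), lintegral_map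
    (Measurable.ennreal_ofReal (Continuous.measurable (by fun_prop)))
    (measurable_pi_lambda _ fun i => hξ _)] at h1
  have e1 : ∀ ω, (![1, -1] ⬝ᵥ fun i => ξ (![t, t'] i) ω) = ξ t ω - ξ t' ω := by
    intro ω
    simp [dotProduct, Fin.sum_univ_two]
    ring
  have e2 : ![1, -1] ⬝ᵥ (Matrix.of fun i j => C (![t, t'] i) (![t, t'] j)).mulVec ![1, -1] =
      C t t - 2 * C t t' + C t' t' := by
    simp [dotProduct, Matrix.mulVec, Fin.sum_univ_two, hC.symm t' t]
    ring
  simpa only [e1, e2] using h1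

/-- All `q-EP(0, C)` processes obey common second-moment bounds. In either description the
increments are controlled by `∑ lam_j (ψ_j(t) - ψ_j(t'))²`. -/
lemma exists_lintegral_sq_le {Ω : Type*} [MeasurableSpace Ω] (P : Measure Ω)
    [IsProbabilityMeasure P] {T : Set ℝ} (hTmeas : MeasurableSet T)
    (hTbdd : Bornology.IsBounded T) [(timeMeasure T).IsOpenPosMeasure] {d : ℕ} {q α : ℝ}
    (hq1 : 1 ≤ q) (hq2 : q ≤ 2) (hα : 0 < α) {C : T → T → ℝ} {lam : ℕ → ℝ} {ψ : ℕ → T → ℝ}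
    (hC : IsEigenSystem C lam ψ) (hlam : Summable fun j => lam j ^ (q / 2))
    (hψ : TemporalHolder d q α lam ψ) :
    ∃ K : ℝ≥0∞, K ≠ ∞ ∧ ∀ ξ : T → Ω → ℝ, IsQEP P q C lam ψ ξ →
      (∀ t, ∫⁻ ω, ENNReal.ofReal (ξ t ω ^ 2) ∂P ≤ K) ∧
      ∀ t t', ∫⁻ ω, ENNReal.ofReal ((ξ t ω - ξ t' ω) ^ 2) ∂P ≤
        K * ENNReal.ofReal (|(t : ℝ) - t'| ^ (2 * (α + d / q))) := by
  have := isFiniteMeasure_timeMeasure hTmeas hTbdd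
  obtain ⟨hcont, ⟨b, hb, hbs⟩, L, hL0, hL, hLs⟩ := hψ.exists_bounds hTbdd hq1 hq2 hα hC hlam
  have hl0 := hC.eigenvalue_nonneg
  have hm1 := qEDMoment_lt_top hq1 hq2 (J := 1) one_le_two
  have hm2 := qEDMoment_lt_top hq1 hq2 (J := 2) le_rfl
  set m := max (qEDMoment q 1) (qEDMoment q 2) with hm
  have hmer := hC.hasSum_mercer hcont hb hbs
  have hsq : ∀ t, HasSum (fun j => lam j * ψ j t ^ 2) (C t t) := fun t => by
    simpa only [pow_two] using hmer t t
  have hinc : ∀ t t', HasSum (fun j => lam j * (ψ j t - ψ j t') ^ 2)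
      (C t t - 2 * C t t' + C t' t') := fun t t' => by
    refine (((hsq t).sub ((hmer t t').mul_left 2)).add (hsq t')).congr_fun ?_
    intro j
    ring
  have hsq_le : ∀ t, C t t ≤ ∑' j, lam j * b j ^ 2 := fun t =>
    hasSum_le (fun j => mul_le_mul_of_nonneg_left
      (sq_le_sq' (abs_le.mp (hb j t)).1 (abs_le.mp (hb j t)).2) (hl0 j)) (hsq t) hbs.hasSum
  have hinc_le : ∀ t t', C t t - 2 * C t t' + C t' t' ≤
      (∑' j, lam j * L j ^ 2) * |(t : ℝ) - t'| ^ (2 * (α + d / q)) := fun t t' => by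
    refine hasSum_le (fun j => ?_) (hinc t t') (hLs.hasSum.mul_right _)
    have h1 : (ψ j t - ψ j t') ^ 2 ≤ (L j * |(t : ℝ) - t'| ^ (α + d / q)) ^ 2 := by
      rw [← sq_abs]
      exact pow_le_pow_left₀ (abs_nonneg _) (hL j t t') 2
    have h2 : |(t : ℝ) - t'| ^ (2 * (α + d / q)) = (|(t : ℝ) - t'| ^ (α + d / q)) ^ 2 := by
      rw [mul_comm, Real.rpow_mul (abs_nonneg _)]
      norm_num
    calc lam j * (ψ j t - ψ j t') ^ 2 ≤ lam j * (L j * |(t : ℝ) - t'| ^ (α + d / q)) ^ 2 :=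
          mul_le_mul_of_nonneg_left h1 (hl0 j)
      _ = _ := by rw [h2]; ring
  refine ⟨ENNReal.ofReal (max (∑' j, lam j * b j ^ 2) (∑' j, lam j * L j ^ 2)) * m,
    ENNReal.mul_ne_top ENNReal.ofReal_ne_top (max_lt hm1 hm2).ne, fun ξ hξ => ⟨fun t => ?_,
      fun t t' => ?_⟩⟩
  · have h1 : ∫⁻ ω, ENNReal.ofReal (ξ t ω ^ 2) ∂P ≤ ENNReal.ofReal (C t t) * qEDMoment q 1 := by
      rcases hξ.2 with h | h
      · exact h.lintegral_sq_le hC hξ.1 t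
      · rw [← (hsq t).tsum_eq]
        exact h.lintegral_sq_le hm1 hl0 t (hsq t).summable
    refine h1.trans ?_
    gcongr
    · exact (hsq_le t).trans (le_max_left _ _)
    · exact le_max_left _ _
  · have h1 : ∫⁻ ω, ENNReal.ofReal ((ξ t ω - ξ t' ω) ^ 2) ∂P ≤
        ENNReal.ofReal (C t t - 2 * C t t' + C t' t') * m := by
      rcases hξ.2 with h | h
      · refine (h.lintegral_sq_sub_le hC hξ.1 t t').trans ?_
        gcongr
        exact le_max_right _ _
      · rw [← (hinc t t').tsum_eq]
        refine (h.lintegral_sq_sub_le hm1 hl0 t t' (hinc t t').summable).trans ?_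
        gcongr
        exact le_max_left _ _
    have h2 : 0 ≤ |(t : ℝ) - t'| ^ (2 * (α + d / q)) := by positivity
    rw [mul_right_comm, ← ENNReal.ofReal_mul' h2]
    refine h1.trans ?_
    gcongr
    refine (hinc_le t t').trans ?_
    gcongr
    exact le_max_right _ _

/-! ### Dyadic nets in a bounded set of times -/

/-- The index of the dyadic cell `[k R / 2 ^ n, (k + 1) R / 2 ^ n)` that contains `t ≥ 0`. -/
noncomputable def dyadicIndex (R : ℝ) (n : ℕ) (t : ℝ) : ℕ := ⌊t * 2 ^ n / R⌋₊

lemma dyadicIndex_bounds {R : ℝ} (hR : 0 < R) (n : ℕ) {t : ℝ} (ht : 0 ≤ t) :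
    (dyadicIndex R n t : ℝ) * (R / 2 ^ n) ≤ t ∧ t < (dyadicIndex R n t + 1) * (R / 2 ^ n) := by
  have h2 : (0 : ℝ) < R / 2 ^ n := by positivity
  have e : t * 2 ^ n / R = t / (R / 2 ^ n) := by field_simp
  constructor
  · rw [← le_div_iff₀ h2, ← e]
    exact Nat.floor_le (by positivity)
  · rw [← div_lt_iff₀ h2, ← e]
    exact Nat.lt_floor_add_one _

lemma dyadicIndex_succ_div_two (R : ℝ) (n : ℕ) (t : ℝ) :
    dyadicIndex R (n + 1) t / 2 = dyadicIndex R n t := by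
  unfold dyadicIndex
  have := Nat.floor_div_natCast (t * 2 ^ (n + 1) / R) 2
  rw [← this]
  congr 1
  push_cast
  ring

lemma dyadicIndex_lt {R : ℝ} (hR : 0 < R) (n : ℕ) {t : ℝ} (ht : 0 ≤ t) (htR : t < R) :
    dyadicIndex R n t < 2 ^ n := by
  unfold dyadicIndex
  rw [Nat.floor_lt (by positivity), div_lt_iff₀ hR]
  push_cast
  nlinarith [show (0 : ℝ) < 2 ^ n by positivity]

lemma abs_sub_le_of_dyadicIndex_eq {R : ℝ} (hR : 0 < R) {n : ℕ} {s t : ℝ} (hs : 0 ≤ s)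
    (ht : 0 ≤ t) (h : dyadicIndex R n s = dyadicIndex R n t) : |s - t| ≤ R / 2 ^ n := by
  have h1 := dyadicIndex_bounds hR n hs
  have h2 := dyadicIndex_bounds hR n ht
  rw [h] at h1
  rw [abs_le]
  constructor <;> nlinarith

lemma abs_sub_le_of_dyadicIndex_le {R : ℝ} (hR : 0 < R) {n : ℕ} {s t : ℝ} (hs : 0 ≤ s)
    (ht : 0 ≤ t) (h : dyadicIndex R n s ≤ dyadicIndex R n t + 1)
    (h' : dyadicIndex R n t ≤ dyadicIndex R n s + 1) : |s - t| ≤ 2 * R / 2 ^ n := by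
  have h1 := dyadicIndex_bounds hR n hs
  have h2 := dyadicIndex_bounds hR n ht
  have h3 : (dyadicIndex R n s : ℝ) ≤ dyadicIndex R n t + 1 := by exact_mod_cast h
  have h4 : (dyadicIndex R n t : ℝ) ≤ dyadicIndex R n s + 1 := by exact_mod_cast h'
  have h5 : (0 : ℝ) < R / 2 ^ n := by positivity
  rw [mul_div_assoc, abs_le]
  constructor <;> nlinarith

lemma dyadicIndex_le_succ {R : ℝ} (hR : 0 < R) {n : ℕ} {s t : ℝ} (hs : 0 ≤ s)
    (ht : 0 ≤ t) (h : |s - t| ≤ R / 2 ^ n) : dyadicIndex R n s ≤ dyadicIndex R n t + 1 := by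
  have h1 := dyadicIndex_bounds hR n hs
  have h2 := dyadicIndex_bounds hR n ht
  have h5 : (0 : ℝ) < R / 2 ^ n := by positivity
  rw [← Nat.lt_succ_iff]
  have h6 := (abs_le.mp h).2
  have h7 : (dyadicIndex R n s : ℝ) * (R / 2 ^ n) < (dyadicIndex R n t + 1 + 1) * (R / 2 ^ n) := by
    nlinarith
  have h8 := lt_of_mul_lt_mul_right h7 h5.le
  exact_mod_cast h8

/-- Approximation of a subset of `[0, R)` by finite nets at the dyadic scales. The finset `E n`
contains the pairs used by chaining at scale `R / 2 ^ n`: the approximations of one point at two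
successive scales, and those of two nearby points at the same scale. -/
lemma exists_dyadic_net {T : Set ℝ} {R : ℝ} (hR : 0 < R) (hT0 : ∀ t : T, 0 ≤ (t : ℝ))
    (hTR : ∀ t : T, (t : ℝ) < R) (t₀ : T) :
    ∃ (π : ℕ → T → T) (E : ℕ → Finset (T × T)),
      (∀ t, π 0 t = π 0 t₀) ∧
      (∀ n t, |(π n t : ℝ) - t| ≤ R / 2 ^ n) ∧
      (∀ n, ((E n).card : ℝ) ≤ 5 * 2 ^ n) ∧
      (∀ n, ∀ p ∈ E n, |(p.1 : ℝ) - p.2| ≤ 2 * R / 2 ^ n) ∧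
      (∀ n t, (π (n + 1) t, π n t) ∈ E n) ∧
      (∀ n (s t : T), |(s : ℝ) - t| ≤ R / 2 ^ n → (π n s, π n t) ∈ E n) := by
  classical
  set idx : ℕ → T → ℕ := fun n t => dyadicIndex R n t with hidx
  -- a point of `T` in the cell `k`, or `t₀` if `T` does not meet this cell
  set p : ℕ → ℕ → T := fun n k => if h : ∃ t, idx n t = k then h.choose else t₀ with hp
  set π : ℕ → T → T := fun n t => p n (idx n t) with hπ
  have hidxπ : ∀ n t, idx n (π n t) = idx n t := by
    intro n t
    have h : ∃ s, idx n s = idx n t := ⟨t, rfl⟩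
    simp only [hπ, hp, dif_pos h]
    exact h.choose_spec
  have hsucc : ∀ n t, idx (n + 1) t / 2 = idx n t := fun n t => dyadicIndex_succ_div_two R n t
  have hlt : ∀ n t, idx n t < 2 ^ n := fun n t => dyadicIndex_lt hR n (hT0 t) (hTR t)
  -- the filter discards pairs spoiled by empty cells; `x.1 + x.2 - 1` runs over `x.1` and its
  -- neighbours
  set E : ℕ → Finset (T × T) := fun n =>
    ((Finset.range (2 ^ (n + 1))).image (fun k => (p (n + 1) k, p n (k / 2))) ∪
      (Finset.range (2 ^ n) ×ˢ Finset.range 3).image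
        (fun x => (p n x.1, p n (x.1 + x.2 - 1)))).filter
      (fun x => |(x.1 : ℝ) - x.2| ≤ 2 * R / 2 ^ n) with hE
  refine ⟨π, E, fun t => ?_, fun n t => ?_, fun n => ?_, fun n x hx => ?_, fun n t => ?_,
    fun n s t hst => ?_⟩
  · have h1 := hlt 0 t
    have h2 := hlt 0 t₀
    simp only [hπ]
    rw [show idx 0 t = idx 0 t₀ by omega]
  · exact abs_sub_le_of_dyadicIndex_eq hR (hT0 _) (hT0 _) (hidxπ n t)
  · have h1 : (E n).card ≤ 2 ^ (n + 1) + 2 ^ n * 3 := by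
      refine (Finset.card_filter_le _ _).trans ((Finset.card_union_le _ _).trans ?_)
      refine Nat.add_le_add (Finset.card_image_le.trans ?_) (Finset.card_image_le.trans ?_)
      · simp
      · simp
    have h2 : ((E n).card : ℝ) ≤ ((2 ^ (n + 1) + 2 ^ n * 3 : ℕ) : ℝ) := by exact_mod_cast h1
    refine h2.trans_eq ?_
    push_cast
    ring
  · exact (Finset.mem_filter.mp hx).2
  · refine Finset.mem_filter.mpr ⟨Finset.mem_union_left _ (Finset.mem_image.mpr
      ⟨idx (n + 1) t, Finset.mem_range.mpr (hlt _ _), ?_⟩), ?_⟩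
    · simp only [hπ, hsucc]
    · have h : idx n (π (n + 1) t) = idx n (π n t) := by
        rw [hidxπ, ← hsucc, hidxπ, hsucc]
      exact abs_sub_le_of_dyadicIndex_le hR (hT0 _) (hT0 _) (h.le.trans (Nat.le_succ _))
        (h.ge.trans (Nat.le_succ _))
  · have h1 : idx n s ≤ idx n t + 1 := dyadicIndex_le_succ hR (hT0 _) (hT0 _) hst
    have h2 : idx n t ≤ idx n s + 1 :=
      dyadicIndex_le_succ hR (hT0 _) (hT0 _) (by rwa [abs_sub_comm])
    refine Finset.mem_filter.mpr ⟨Finset.mem_union_right _ (Finset.mem_image.mpr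
      ⟨(idx n s, idx n t + 1 - idx n s), ?_, ?_⟩), ?_⟩
    · simp only [Finset.mem_product, Finset.mem_range]
      exact ⟨hlt _ _, by omega⟩
    · simp only [hπ]
      rw [show idx n s + (idx n t + 1 - idx n s) - 1 = idx n t by omega]
    · rw [← hidxπ n s, ← hidxπ n t] at h1 h2
      exact abs_sub_le_of_dyadicIndex_le hR (hT0 _) (hT0 _) h1 h2

/-! ### Hölder continuous versions from second moments of increments -/

/-- Deterministic chaining: increments of order `G 2^(-β n)` along the pairs of the dyadic net
yield a limit that is bounded and `β`-Hölder continuous. -/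
lemma exists_holder_limit {T : Set ℝ} {R β : ℝ} (hR : 0 < R) (hβ : 0 < β)
    (hT0 : ∀ t : T, 0 ≤ (t : ℝ)) (hTR : ∀ t : T, (t : ℝ) < R) {π : ℕ → T → T}
    {E : ℕ → Finset (T × T)} (hE1 : ∀ n t, (π (n + 1) t, π n t) ∈ E n)
    (hE2 : ∀ n (s t : T), |(s : ℝ) - t| ≤ R / 2 ^ n → (π n s, π n t) ∈ E n)
    {f : T → ℝ} {G : ℝ} (hG : 0 ≤ G)
    (hf : ∀ n, ∀ p ∈ E n, |f p.1 - f p.2| ≤ G * ((2 : ℝ) ^ (-β)) ^ n) :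
    ∃ g : T → ℝ, (∀ t, Tendsto (fun n => f (π n t)) atTop (𝓝 (g t))) ∧
      (∀ t, |g t - f (π 0 t)| ≤ (1 - (2 : ℝ) ^ (-β))⁻¹ * G) ∧
      ∀ s t, |g s - g t| ≤
        ((2 / (1 - (2 : ℝ) ^ (-β)) + 1) * (2 / R) ^ β) * G * |(s : ℝ) - t| ^ β := by
  set r : ℝ := (2 : ℝ) ^ (-β) with hr
  have hr0 : 0 < r := by positivity
  have hr1 : r < 1 := Real.rpow_lt_one_of_one_lt_of_neg one_lt_two (by linarith)
  have hstep : ∀ t n, dist (f (π n t)) (f (π (n + 1) t)) ≤ G * r ^ n := by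
    intro t n
    rw [dist_comm, Real.dist_eq]
    exact hf n _ (hE1 n t)
  have hlim : ∀ t, ∃ x, Tendsto (fun n => f (π n t)) atTop (𝓝 x) := fun t =>
    cauchySeq_tendsto_of_complete (cauchySeq_of_le_geometric r G hr1 (hstep t))
  choose g hg using hlim
  have hdist : ∀ n t, |f (π n t) - g t| ≤ G * r ^ n / (1 - r) := fun n t =>
    dist_le_of_le_geometric_of_tendsto r G hr1 (hstep t) (hg t) n
  refine ⟨g, hg, fun t => ?_, fun s t => ?_⟩
  · rw [abs_sub_comm]
    refine (hdist 0 t).trans_eq ?_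
    rw [pow_zero, mul_one, div_eq_mul_inv, mul_comm]
  · rcases eq_or_ne s t with rfl | hne
    · simp [Real.zero_rpow hβ.ne']
    have hpos : 0 < |(s : ℝ) - t| := abs_pos.mpr (sub_ne_zero.mpr fun h => hne (Subtype.ext h))
    have hle : |(s : ℝ) - t| ≤ R := by
      rw [abs_le]
      constructor <;> linarith [hT0 s, hT0 t, hTR s, hTR t]
    -- the scale `n` at which the two points are just resolved
    obtain ⟨n, hn1, hn2⟩ := exists_nat_pow_near_of_lt_one (x := |(s : ℝ) - t| / R)
      (y := 1 / 2) (by positivity) ((div_le_one hR).mpr hle) (by norm_num) (by norm_num)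
    have h1 : |(s : ℝ) - t| ≤ R / 2 ^ n := by
      rw [div_le_iff₀ hR] at hn2
      refine hn2.trans_eq ?_
      rw [one_div, inv_pow]
      field_simp
    have h2 : r ^ n ≤ (2 / R) ^ β * |(s : ℝ) - t| ^ β := by
      have e1 : r ^ n = ((1 / 2 : ℝ) ^ n) ^ β := by
        rw [hr, ← Real.rpow_natCast, ← Real.rpow_natCast, ← Real.rpow_mul (by norm_num),
          ← Real.rpow_mul (by norm_num), one_div, Real.inv_rpow (by norm_num),
          ← Real.rpow_neg (by norm_num)]
        congr 1
        ring
      rw [e1, ← Real.mul_rpow (by positivity) hpos.le]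
      apply Real.rpow_le_rpow (by positivity) _ hβ.le
      have : (1 / 2 : ℝ) ^ n = 2 * (1 / 2) ^ (n + 1) := by ring
      rw [this]
      calc 2 * (1 / 2 : ℝ) ^ (n + 1) ≤ 2 * (|(s : ℝ) - t| / R) := by linarith
        _ = _ := by ring
    have h3 : |f (π n s) - f (π n t)| ≤ G * r ^ n := hf n _ (hE2 n s t h1)
    have h4 := hdist n s
    have h5 := hdist n t
    rw [abs_sub_comm] at h4
    have h6 : 0 < 1 - r := by linarith
    calc |g s - g t| = |(g s - f (π n s)) + (f (π n s) - f (π n t)) + (f (π n t) - g t)| := by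
          ring_nf
      _ ≤ |g s - f (π n s)| + |f (π n s) - f (π n t)| + |f (π n t) - g t| := abs_add_three _ _ _
      _ ≤ G * r ^ n / (1 - r) + G * r ^ n + G * r ^ n / (1 - r) := by linarith
      _ = (2 / (1 - r) + 1) * G * r ^ n := by ring
      _ ≤ (2 / (1 - r) + 1) * G * ((2 / R) ^ β * |(s : ℝ) - t| ^ β) := by gcongr
      _ = _ := by ring

/-- Kolmogorov's continuity theorem for second moments, on a bounded subset of the line, with a
bound on the second moment of the random Hölder constant that is uniform over all processes with
the given moment bounds. -/
theorem exists_holder_version {Ω : Type*} [MeasurableSpace Ω] (P : Measure Ω) {T : Set ℝ}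
    [Nonempty T] (hT0 : ∀ t : T, 0 ≤ (t : ℝ)) (hTbdd : Bornology.IsBounded T) {β γ : ℝ}
    (hβ : 0 < β) (hβγ : β < γ) {K : ℝ≥0∞} (hK : K ≠ ∞) :
    ∃ K' : ℝ≥0∞, K' ≠ ∞ ∧ ∀ ξ : T → Ω → ℝ, (∀ t, Measurable (ξ t)) →
      (∀ t, ∫⁻ ω, ENNReal.ofReal (ξ t ω ^ 2) ∂P ≤ K) →
      (∀ t t', ∫⁻ ω, ENNReal.ofReal ((ξ t ω - ξ t' ω) ^ 2) ∂P ≤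
        K * ENNReal.ofReal (|(t : ℝ) - t'| ^ (1 + 2 * γ))) →
      ∃ (η : T → Ω → ℝ) (H : Ω → ℝ), (∀ t, Measurable (η t)) ∧ Measurable H ∧
        (∀ t, ∀ᵐ ω ∂P, η t ω = ξ t ω) ∧ (∀ ω, 0 ≤ H ω) ∧ (∀ t ω, |η t ω| ≤ H ω) ∧
        (∀ s t ω, |η s ω - η t ω| ≤ H ω * |(s : ℝ) - t| ^ β) ∧
        ∫⁻ ω, ENNReal.ofReal (H ω ^ 2) ∂P ≤ K' := by
  classical
  obtain ⟨t₀⟩ := ‹Nonempty T›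
  obtain ⟨R, hR, hTR⟩ : ∃ R : ℝ, 0 < R ∧ ∀ t : T, (t : ℝ) < R := by
    obtain ⟨R, hR0, hR⟩ := hTbdd.exists_pos_norm_lt
    exact ⟨R, hR0, fun t => (le_abs_self _).trans_lt (hR t t.2)⟩
  obtain ⟨π, E, hπ0, hπ, hcard, hEd, hE1, hE2⟩ := exists_dyadic_net hR hT0 hTR t₀
  set r : ℝ := (2 : ℝ) ^ (-β) with hr
  have hr0 : 0 < r := by positivity
  have hr1 : r < 1 := Real.rpow_lt_one_of_one_lt_of_neg one_lt_two (by linarith)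
  set ρ : ℝ := (2 : ℝ) ^ (2 * (β - γ)) with hρ
  have hρ0 : 0 < ρ := by positivity
  have hρ1 : ρ < 1 := Real.rpow_lt_one_of_one_lt_of_neg one_lt_two (by linarith)
  set c : ℝ := (1 - r)⁻¹ + (2 / (1 - r) + 1) * (2 / R) ^ β with hc
  have h1r : 0 < 1 - r := by linarith
  have hc1 : 0 ≤ (1 - r)⁻¹ := by positivity
  have hc2 : 0 ≤ (2 / (1 - r) + 1) * (2 / R) ^ β := by positivity
  have hc0 : 0 ≤ c := by positivity
  set B : ℝ≥0∞ := ENNReal.ofReal (5 * (2 * R) ^ (1 + 2 * γ)) * K with hB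
  have hBtop : B ≠ ∞ := ENNReal.mul_ne_top ENNReal.ofReal_ne_top hK
  refine ⟨2 * K + ENNReal.ofReal (2 * c ^ 2) * (B * ∑' n : ℕ, ENNReal.ofReal (ρ ^ n)), ?_, ?_⟩
  · have h1 : ∑' n : ℕ, ENNReal.ofReal (ρ ^ n) ≠ ∞ := by
      rw [← ENNReal.ofReal_tsum_of_nonneg (fun n => by positivity)
        (summable_geometric_of_lt_one hρ0.le hρ1)]
      exact ENNReal.ofReal_ne_top
    exact ENNReal.add_ne_top.mpr ⟨ENNReal.mul_ne_top (by norm_num) hK,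
      ENNReal.mul_ne_top ENNReal.ofReal_ne_top (ENNReal.mul_ne_top hBtop h1)⟩
  intro ξ hξ hξ1 hξ2
  -- the weighted sum of all squared increments over the net
  set Q : Ω → ℝ≥0∞ := fun ω => ∑' n : ℕ, ENNReal.ofReal ((r ^ n)⁻¹ ^ 2) *
    ∑ p ∈ E n, ENNReal.ofReal ((ξ p.1 ω - ξ p.2 ω) ^ 2) with hQ
  have hterm : ∀ p : T × T, Measurable fun ω => ENNReal.ofReal ((ξ p.1 ω - ξ p.2 ω) ^ 2) :=
    fun p => (((hξ p.1).sub (hξ p.2)).pow_const 2).ennreal_ofReal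
  have hterm' : ∀ n, Measurable fun ω =>
      ∑ p ∈ E n, ENNReal.ofReal ((ξ p.1 ω - ξ p.2 ω) ^ 2) := fun n =>
    Finset.measurable_fun_sum _ fun p _ => hterm p
  have hQm : Measurable Q := Measurable.tsum fun n => (hterm' n).const_mul _
  have hQint : ∫⁻ ω, Q ω ∂P ≤ B * ∑' n : ℕ, ENNReal.ofReal (ρ ^ n) := by
    rw [hQ, lintegral_tsum fun n => ((hterm' n).const_mul _).aemeasurable, ← ENNReal.tsum_mul_left]
    refine ENNReal.tsum_le_tsum fun n => ?_
    rw [lintegral_const_mul' _ _ ENNReal.ofReal_ne_top, lintegral_finsetSum _ fun p _ => hterm p]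
    have h1 : ∑ p ∈ E n, ∫⁻ ω, ENNReal.ofReal ((ξ p.1 ω - ξ p.2 ω) ^ 2) ∂P ≤
        ENNReal.ofReal (5 * 2 ^ n) * (K * ENNReal.ofReal ((2 * R / 2 ^ n) ^ (1 + 2 * γ))) := by
      calc ∑ p ∈ E n, ∫⁻ ω, ENNReal.ofReal ((ξ p.1 ω - ξ p.2 ω) ^ 2) ∂P
          ≤ ∑ _p ∈ E n, K * ENNReal.ofReal ((2 * R / 2 ^ n) ^ (1 + 2 * γ)) := by
            refine Finset.sum_le_sum fun p hp => (hξ2 _ _).trans ?_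
            gcongr
            · linarith
            · exact hEd n p hp
        _ = ENNReal.ofReal (E n).card * (K * ENNReal.ofReal ((2 * R / 2 ^ n) ^ (1 + 2 * γ))) := by
            rw [Finset.sum_const, nsmul_eq_mul, ENNReal.ofReal_natCast]
        _ ≤ _ := by
            gcongr
            exact hcard n
    have h2 : (r ^ n)⁻¹ ^ 2 * (5 * 2 ^ n) * (2 * R / 2 ^ n) ^ (1 + 2 * γ) =
        5 * (2 * R) ^ (1 + 2 * γ) * ρ ^ n := by
      rw [Real.div_rpow (by positivity) (by positivity)]
      have e1 : (r ^ n)⁻¹ ^ 2 = (2 : ℝ) ^ (2 * β * n) := by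
        rw [hr, ← Real.rpow_natCast, ← Real.rpow_natCast, ← Real.rpow_mul (by norm_num),
          ← Real.rpow_neg (by norm_num), ← Real.rpow_mul (by norm_num)]
        congr 1
        push_cast
        ring
      have e2 : ρ ^ n = (2 : ℝ) ^ (2 * β * n) / (2 : ℝ) ^ (2 * γ * n) := by
        rw [hρ, ← Real.rpow_natCast, ← Real.rpow_mul (by norm_num),
          ← Real.rpow_sub (by norm_num)]
        congr 1
        ring
      have e3 : ((2 : ℝ) ^ n) ^ (1 + 2 * γ) = 2 ^ n * (2 : ℝ) ^ (2 * γ * n) := by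
        rw [Real.rpow_add (by positivity), Real.rpow_one, ← Real.rpow_natCast 2 n,
          ← Real.rpow_mul (by norm_num)]
        congr 2
        ring
      rw [e1, e2, e3]
      field_simp
    calc ENNReal.ofReal ((r ^ n)⁻¹ ^ 2) *
          ∑ p ∈ E n, ∫⁻ ω, ENNReal.ofReal ((ξ p.1 ω - ξ p.2 ω) ^ 2) ∂P
        ≤ ENNReal.ofReal ((r ^ n)⁻¹ ^ 2) * (ENNReal.ofReal (5 * 2 ^ n) *
          (K * ENNReal.ofReal ((2 * R / 2 ^ n) ^ (1 + 2 * γ)))) := by gcongr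
      _ = ENNReal.ofReal ((r ^ n)⁻¹ ^ 2 * (5 * 2 ^ n) * (2 * R / 2 ^ n) ^ (1 + 2 * γ)) * K := by
        rw [ENNReal.ofReal_mul (p := (r ^ n)⁻¹ ^ 2 * (5 * 2 ^ n)) (by positivity),
          ENNReal.ofReal_mul (p := (r ^ n)⁻¹ ^ 2) (by positivity)]
        ring
      _ = B * ENNReal.ofReal (ρ ^ n) := by
        rw [h2, ENNReal.ofReal_mul (by positivity), hB]
        ring
  have hQtop : ∀ᵐ ω ∂P, Q ω < ∞ := by
    refine ae_lt_top hQm (ne_top_of_le_ne_top ?_ hQint)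
    refine ENNReal.mul_ne_top hBtop ?_
    rw [← ENNReal.ofReal_tsum_of_nonneg (fun n => by positivity)
      (summable_geometric_of_lt_one hρ0.le hρ1)]
    exact ENNReal.ofReal_ne_top
  set G : Ω → ℝ := fun ω => Real.sqrt (Q ω).toReal with hG
  have hGm : Measurable G := hQm.ennreal_toReal.sqrt
  have hG0 : ∀ ω, 0 ≤ G ω := fun ω => Real.sqrt_nonneg _
  have hGinc : ∀ ω, Q ω < ∞ → ∀ n, ∀ p ∈ E n,
      |ξ p.1 ω - ξ p.2 ω| ≤ G ω * ((2 : ℝ) ^ (-β)) ^ n := by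
    intro ω hω n p hp
    have h1 : ENNReal.ofReal (((r ^ n)⁻¹ * (ξ p.1 ω - ξ p.2 ω)) ^ 2) ≤ Q ω := by
      rw [mul_pow, ENNReal.ofReal_mul (by positivity)]
      refine le_trans ?_ (ENNReal.le_tsum n)
      gcongr
      exact Finset.single_le_sum (f := fun p : T × T => ENNReal.ofReal ((ξ p.1 ω - ξ p.2 ω) ^ 2))
        (fun _ _ => zero_le) hp
    have h2 := Real.abs_le_sqrt ((ENNReal.ofReal_le_iff_le_toReal hω.ne).mp h1)
    rw [abs_mul, abs_of_pos (by positivity : 0 < (r ^ n)⁻¹),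
      inv_mul_le_iff₀ (by positivity), mul_comm] at h2
    exact h2
  have hpath : ∀ ω, ∃ g : T → ℝ,
      (∀ t, Tendsto (fun n => if Q ω < ∞ then ξ (π n t) ω else 0) atTop (𝓝 (g t))) ∧
      (∀ t, |g t| ≤ |ξ (π 0 t₀) ω| + c * G ω) ∧
      ∀ s t, |g s - g t| ≤ (|ξ (π 0 t₀) ω| + c * G ω) * |(s : ℝ) - t| ^ β := by
    intro ω
    by_cases hω : Q ω < ∞
    · obtain ⟨g, hg1, hg2, hg3⟩ := exists_holder_limit hR hβ hT0 hTR hE1 hE2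
        (f := fun t => ξ t ω) (hG0 ω) (hGinc ω hω)
      refine ⟨g, fun t => ?_, fun t => ?_, fun s t => ?_⟩
      · simpa only [if_pos hω] using hg1 t
      · have h1 := hg2 t
        rw [hπ0 t] at h1
        have h2 := abs_sub_abs_le_abs_sub (g t) (ξ (π 0 t₀) ω)
        have h3 : (1 - r)⁻¹ * G ω ≤ c * G ω :=
          mul_le_mul_of_nonneg_right (by rw [hc]; linarith) (hG0 ω)
        linarith
      · refine (hg3 s t).trans (mul_le_mul_of_nonneg_right ?_ (by positivity))
        have h3 : (2 / (1 - r) + 1) * (2 / R) ^ β * G ω ≤ c * G ω :=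
          mul_le_mul_of_nonneg_right (by rw [hc]; linarith) (hG0 ω)
        linarith [abs_nonneg (ξ (π 0 t₀) ω)]
    · have h0 : 0 ≤ |ξ (π 0 t₀) ω| + c * G ω :=
        add_nonneg (abs_nonneg _) (mul_nonneg hc0 (hG0 ω))
      refine ⟨fun _ => 0, fun t => ?_, fun t => by simpa using h0, fun s t => ?_⟩
      · simp [hω]
      · rw [sub_self, abs_zero]
        positivity
  choose g hg1 hg2 hg3 using hpath
  have hgm : ∀ t, Measurable fun ω => g ω t := by
    intro t
    refine measurable_of_tendsto_metrizable (f := fun n ω => if Q ω < ∞ then ξ (π n t) ω else 0)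
      (fun n => Measurable.ite (measurableSet_lt hQm measurable_const) (hξ _) measurable_const) ?_
    rw [tendsto_pi_nhds]
    exact fun ω => hg1 ω t
  refine ⟨fun t ω => g ω t, fun ω => |ξ (π 0 t₀) ω| + c * G ω, hgm, ?_, fun t => ?_,
    fun ω => add_nonneg (abs_nonneg _) (mul_nonneg hc0 (hG0 ω)), fun t ω => hg2 ω t,
    fun s t ω => hg3 ω s t, ?_⟩
  · exact (measurable_norm.comp (hξ _)).add (hGm.const_mul c)
  · -- the `L²` limit `ξ t` and the pointwise limit of `ξ (π n t)` agree, by Fatou's lemma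
    have hS : ∀ n, Measurable fun ω => ENNReal.ofReal ((ξ (π n t) ω - ξ t ω) ^ 2) :=
      fun n => hterm (π n t, t)
    have hto0 : Tendsto (fun n => K * ENNReal.ofReal ((R / 2 ^ n) ^ (1 + 2 * γ))) atTop (𝓝 0) := by
      have h1 : Tendsto (fun n : ℕ => R / 2 ^ n) atTop (𝓝 0) :=
        tendsto_const_nhds.div_atTop (tendsto_pow_atTop_atTop_of_one_lt one_lt_two)
      have h2 : Tendsto (fun n : ℕ => (R / 2 ^ n) ^ (1 + 2 * γ)) atTop (𝓝 0) := by
        have := h1.rpow_const (p := 1 + 2 * γ) (Or.inr (by linarith))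
        rwa [Real.zero_rpow (by linarith)] at this
      have h3 := ENNReal.Tendsto.const_mul (a := K) (ENNReal.tendsto_ofReal h2) (Or.inr hK)
      simpa using h3
    have hint : ∫⁻ ω, ENNReal.ofReal ((g ω t - ξ t ω) ^ 2) ∂P = 0 := by
      refine le_antisymm ?_ zero_le
      calc ∫⁻ ω, ENNReal.ofReal ((g ω t - ξ t ω) ^ 2) ∂P
          = ∫⁻ ω, liminf (fun n => ENNReal.ofReal ((ξ (π n t) ω - ξ t ω) ^ 2)) atTop ∂P := by
            refine lintegral_congr_ae ?_
            filter_upwards [hQtop] with ω hω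
            have h1 := hg1 ω t
            simp only [if_pos hω] at h1
            exact ((ENNReal.tendsto_ofReal ((h1.sub_const _).pow 2)).liminf_eq).symm
        _ ≤ liminf (fun n => ∫⁻ ω, ENNReal.ofReal ((ξ (π n t) ω - ξ t ω) ^ 2) ∂P) atTop :=
            lintegral_liminf_le hS
        _ ≤ liminf (fun n => K * ENNReal.ofReal ((R / 2 ^ n) ^ (1 + 2 * γ))) atTop := by
            refine liminf_le_liminf (Eventually.of_forall fun n => (hξ2 _ _).trans ?_)
            gcongr
            · linarith
            · exact hπ n t
        _ = 0 := hto0.liminf_eq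
    have hdm : Measurable fun ω => ENNReal.ofReal ((g ω t - ξ t ω) ^ 2) :=
      (((hgm t).sub (hξ t)).pow_const 2).ennreal_ofReal
    rw [lintegral_eq_zero_iff hdm] at hint
    filter_upwards [hint] with ω hω
    simp only [Pi.zero_apply, ENNReal.ofReal_eq_zero] at hω
    have := pow_eq_zero_iff two_ne_zero |>.mp (le_antisymm hω (sq_nonneg _))
    linarith
  · have hle : ∀ ω, Q ω < ∞ → ENNReal.ofReal ((|ξ (π 0 t₀) ω| + c * G ω) ^ 2) ≤
        2 * ENNReal.ofReal (ξ (π 0 t₀) ω ^ 2) + ENNReal.ofReal (2 * c ^ 2) * Q ω := by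
      intro ω hω
      have e : Q ω = ENNReal.ofReal (G ω ^ 2) := by
        rw [hG, Real.sq_sqrt ENNReal.toReal_nonneg, ENNReal.ofReal_toReal hω.ne]
      rw [e, ← ENNReal.ofReal_mul (by positivity),
        show (2 : ℝ≥0∞) = ENNReal.ofReal 2 by simp, ← ENNReal.ofReal_mul (by norm_num),
        ← ENNReal.ofReal_add (by positivity) (by positivity)]
      apply ENNReal.ofReal_le_ofReal
      nlinarith [sq_nonneg (|ξ (π 0 t₀) ω| - c * G ω), sq_abs (ξ (π 0 t₀) ω)]
    have hm1 : Measurable fun ω => 2 * ENNReal.ofReal (ξ (π 0 t₀) ω ^ 2) :=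
      ((hξ _).pow_const 2).ennreal_ofReal.const_mul 2
    calc ∫⁻ ω, ENNReal.ofReal ((|ξ (π 0 t₀) ω| + c * G ω) ^ 2) ∂P
        ≤ ∫⁻ ω, (2 * ENNReal.ofReal (ξ (π 0 t₀) ω ^ 2) + ENNReal.ofReal (2 * c ^ 2) * Q ω) ∂P := by
          refine lintegral_mono_ae ?_
          filter_upwards [hQtop] with ω hω using hle ω hω
      _ = 2 * ∫⁻ ω, ENNReal.ofReal (ξ (π 0 t₀) ω ^ 2) ∂P +
          ENNReal.ofReal (2 * c ^ 2) * ∫⁻ ω, Q ω ∂P := by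
          rw [lintegral_add_left hm1, lintegral_const_mul' _ _ (by norm_num),
            lintegral_const_mul' _ _ ENNReal.ofReal_ne_top]
      _ ≤ _ := by
          gcongr
          exact hξ1 _

/-! ### The Besov norm of the process -/

/-- The weights combine as `ℓ^(τ_q(s') q) γ_ℓ^q = κ^q ℓ^((s'-s)q/d)`; the factor `|T|` comes from
measuring constants in `L^q(T)`. -/
lemma besovNormConst_le {d : ℕ} {T : Set ℝ} {q s s' κ : ℝ} (hq : 1 ≤ q)
    (hκ : 0 < κ) {c h : ℕ → ℝ} {ρ : ℝ} (hh : ∀ ℓ, 0 ≤ h ℓ)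
    (hc : ∀ ℓ, |c ℓ| ≤ κ * ((ℓ : ℝ) + 1) ^ (-tau d q s) * (h ℓ * ρ)) :
    besovNormConst d T s' q c ≤
      (timeMeasure T Set.univ * ENNReal.ofReal κ ^ q *
        ∑' ℓ : ℕ, ENNReal.ofReal (((ℓ : ℝ) + 1) ^ ((s' - s) / d * q)) *
          ENNReal.ofReal (h ℓ) ^ q) ^ (1 / q) * ENNReal.ofReal ρ := by
  have hq0 : 0 < q := by linarith
  have hρe : ENNReal.ofReal ρ = (ENNReal.ofReal ρ ^ q) ^ (1 / q) := by
    rw [← ENNReal.rpow_mul, mul_one_div_cancel hq0.ne', ENNReal.rpow_one]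
  rw [hρe, ← ENNReal.mul_rpow_of_nonneg _ _ (by positivity), besovNormConst, besovNorm]
  refine ENNReal.rpow_le_rpow ?_ (by positivity)
  rw [mul_assoc _ _ (ENNReal.ofReal ρ ^ q), ← ENNReal.tsum_mul_right, ← ENNReal.tsum_mul_left]
  refine ENNReal.tsum_le_tsum fun ℓ => ?_
  have hl : (0 : ℝ) < (ℓ : ℝ) + 1 := by positivity
  rw [eLpNorm_const' _ (by simpa using hq0) ENNReal.ofReal_ne_top,
    ENNReal.toReal_ofReal hq0.le, ENNReal.mul_rpow_of_nonneg _ _ hq0.le, ← ENNReal.rpow_mul,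
    one_div_mul_cancel hq0.ne', ENNReal.rpow_one]
  have h1 : ‖c ℓ‖ₑ ^ q ≤ ENNReal.ofReal κ ^ q *
      ENNReal.ofReal (((ℓ : ℝ) + 1) ^ (-tau d q s * q)) *
        (ENNReal.ofReal (h ℓ) ^ q * ENNReal.ofReal ρ ^ q) := by
    have h2 : ‖c ℓ‖ₑ ≤ ENNReal.ofReal κ * ENNReal.ofReal (((ℓ : ℝ) + 1) ^ (-tau d q s)) *
        (ENNReal.ofReal (h ℓ) * ENNReal.ofReal ρ) := by
      rw [← ofReal_norm, ← ENNReal.ofReal_mul hκ.le, ← ENNReal.ofReal_mul (hh ℓ),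
        ← ENNReal.ofReal_mul (by positivity)]
      exact ENNReal.ofReal_le_ofReal (hc ℓ)
    refine (ENNReal.rpow_le_rpow h2 hq0.le).trans_eq ?_
    rw [ENNReal.mul_rpow_of_nonneg _ _ hq0.le, ENNReal.mul_rpow_of_nonneg _ _ hq0.le,
      ENNReal.mul_rpow_of_nonneg _ _ hq0.le,
      ENNReal.ofReal_rpow_of_nonneg (by positivity : 0 ≤ ((ℓ : ℝ) + 1) ^ (-tau d q s)) hq0.le,
      ← Real.rpow_mul hl.le]
  have h3 : ENNReal.ofReal (((ℓ : ℝ) + 1) ^ (tau d q s' * q)) *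
      ENNReal.ofReal (((ℓ : ℝ) + 1) ^ (-tau d q s * q)) =
      ENNReal.ofReal (((ℓ : ℝ) + 1) ^ ((s' - s) / d * q)) := by
    rw [← ENNReal.ofReal_mul (by positivity), ← Real.rpow_add hl]
    congr 2
    unfold tau
    ring
  calc _ ≤ ENNReal.ofReal (((ℓ : ℝ) + 1) ^ (tau d q s' * q)) *
        (ENNReal.ofReal κ ^ q * ENNReal.ofReal (((ℓ : ℝ) + 1) ^ (-tau d q s * q)) *
          (ENNReal.ofReal (h ℓ) ^ q * ENNReal.ofReal ρ ^ q) * timeMeasure T Set.univ) := by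
        gcongr
    _ = timeMeasure T Set.univ * ENNReal.ofReal κ ^ q *
        ((ENNReal.ofReal (((ℓ : ℝ) + 1) ^ (tau d q s' * q)) *
          ENNReal.ofReal (((ℓ : ℝ) + 1) ^ (-tau d q s * q))) *
          ENNReal.ofReal (h ℓ) ^ q * ENNReal.ofReal ρ ^ q) := by ring
    _ = _ := by rw [h3]

/-- The spatial Hölder condition in terms of one constant per function: `φ_ℓ` is bounded by `A_ℓ`
and, after interpolation between the two bounds, `β`-Hölder with a constant `A_ℓ` at all
distances. -/
lemma SpatialHolder.exists_bounds {d : ℕ} {X : Set (EuclideanSpace ℝ (Fin d))}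
    {q s s' α β : ℝ} (hq : 1 ≤ q) (hβ : 0 < β) (hβα : β < α) {φ : ℕ → X → ℝ}
    (hφ : SpatialHolder q s s' α φ) :
    ∃ A : ℕ → ℝ, (∀ ℓ, 0 ≤ A ℓ) ∧ (∀ ℓ x, |φ ℓ x| ≤ A ℓ) ∧
      (∀ ℓ x x', |φ ℓ x - φ ℓ x'| ≤ A ℓ * ‖(x : EuclideanSpace ℝ (Fin d)) - x'‖ ^ β) ∧
      ∑' ℓ : ℕ, ENNReal.ofReal (((ℓ : ℝ) + 1) ^ ((s' - s) / d * q)) *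
        ENNReal.ofReal (A ℓ) ^ q ≠ ∞ := by
  obtain ⟨⟨L, hL0, hL, hLs⟩, hM⟩ := hφ
  have hq0 : 0 < q := by linarith
  set W : ℕ → ℝ≥0∞ := fun ℓ => ENNReal.ofReal (((ℓ : ℝ) + 1) ^ ((s' - s) / d * q)) with hW
  have hW0 : ∀ ℓ, W ℓ ≠ 0 := fun ℓ => by
    have : (0 : ℝ) < ((ℓ : ℝ) + 1) ^ ((s' - s) / d * q) := by positivity
    simpa [hW] using this
  have hsup : ∀ ℓ, (⨆ x, ‖φ ℓ x‖ₑ) ≠ ∞ := by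
    intro ℓ h
    refine ENNReal.ne_top_of_tsum_ne_top hM ℓ ?_
    rw [h, ENNReal.top_rpow_of_pos hq0]
    exact ENNReal.mul_top (hW0 ℓ)
  set m : ℕ → ℝ := fun ℓ => (⨆ x, ‖φ ℓ x‖ₑ).toReal with hm
  have hm0 : ∀ ℓ, 0 ≤ m ℓ := fun ℓ => ENNReal.toReal_nonneg
  have hφm : ∀ ℓ x, |φ ℓ x| ≤ m ℓ := by
    intro ℓ x
    have := ENNReal.toReal_mono (hsup ℓ) (le_iSup (fun x => ‖φ ℓ x‖ₑ) x)
    simpa using this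
  refine ⟨fun ℓ => L ℓ + 2 * m ℓ, fun ℓ => by linarith [hL0 ℓ, hm0 ℓ],
    fun ℓ x => by linarith [hφm ℓ x, hL0 ℓ, hm0 ℓ], fun ℓ x x' => ?_, ?_⟩
  · set y := ‖(x : EuclideanSpace ℝ (Fin d)) - x'‖ with hy
    have hy0 : 0 ≤ y := norm_nonneg _
    -- at distances below `1` the given modulus is the stronger one, beyond `1` boundedness suffices
    rcases le_total y 1 with h1 | h1
    · have h2 : y ^ (α + d / q) ≤ y ^ β := by
        have : 0 ≤ (d : ℝ) / q := by positivity
        rcases hy0.eq_or_lt with h0 | h0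
        · rw [← h0, Real.zero_rpow hβ.ne', Real.zero_rpow (by linarith)]
        · exact Real.rpow_le_rpow_of_exponent_ge h0 h1 (by linarith)
      calc |φ ℓ x - φ ℓ x'| ≤ L ℓ * y ^ (α + d / q) := hL ℓ x x'
        _ ≤ L ℓ * y ^ β := mul_le_mul_of_nonneg_left h2 (hL0 ℓ)
        _ ≤ (L ℓ + 2 * m ℓ) * y ^ β :=
          mul_le_mul_of_nonneg_right (by linarith [hm0 ℓ]) (by positivity)
    · have h2 : 1 ≤ y ^ β := Real.one_le_rpow h1 hβ.le
      calc |φ ℓ x - φ ℓ x'| ≤ |φ ℓ x| + |φ ℓ x'| := abs_sub _ _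
        _ ≤ (L ℓ + 2 * m ℓ) * 1 := by linarith [hφm ℓ x, hφm ℓ x', hL0 ℓ]
        _ ≤ _ := mul_le_mul_of_nonneg_left h2 (by linarith [hm0 ℓ, hL0 ℓ])
  · have hLs' : ∑' ℓ : ℕ, W ℓ * ENNReal.ofReal (L ℓ) ^ q ≠ ∞ := by
      have h : ∀ ℓ : ℕ, W ℓ * ENNReal.ofReal (L ℓ) ^ q =
          ENNReal.ofReal (((ℓ : ℝ) + 1) ^ ((s' - s) / d * q) * L ℓ ^ q) := by
        intro ℓ
        rw [ENNReal.ofReal_rpow_of_nonneg (hL0 ℓ) hq0.le, ENNReal.ofReal_mul (by positivity)]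
      simp_rw [h]
      rw [← ENNReal.ofReal_tsum_of_nonneg (fun ℓ => mul_nonneg (by positivity)
        (Real.rpow_nonneg (hL0 ℓ) q)) hLs]
      exact ENNReal.ofReal_ne_top
    have hle : ∀ ℓ, W ℓ * ENNReal.ofReal (L ℓ + 2 * m ℓ) ^ q ≤
        2 ^ (q - 1) * (W ℓ * ENNReal.ofReal (L ℓ) ^ q +
          2 ^ q * (W ℓ * (⨆ x, ‖φ ℓ x‖ₑ) ^ q)) := by
      intro ℓ
      have h1 : ENNReal.ofReal (L ℓ + 2 * m ℓ) =
          ENNReal.ofReal (L ℓ) + 2 * ⨆ x, ‖φ ℓ x‖ₑ := by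
        rw [ENNReal.ofReal_add (hL0 ℓ) (by linarith [hm0 ℓ]), ENNReal.ofReal_mul (by norm_num),
          hm, ENNReal.ofReal_toReal (hsup ℓ)]
        simp
      have h2 := ENNReal.rpow_add_le_mul_rpow_add_rpow (ENNReal.ofReal (L ℓ))
        (2 * ⨆ x, ‖φ ℓ x‖ₑ) hq
      rw [h1]
      refine (mul_le_mul_right h2 (W ℓ)).trans_eq ?_
      rw [ENNReal.mul_rpow_of_nonneg _ _ hq0.le]
      ring
    refine ne_top_of_le_ne_top ?_ (ENNReal.tsum_le_tsum hle)
    rw [ENNReal.tsum_mul_left, ENNReal.tsum_add, ENNReal.tsum_mul_left]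
    have h2 : ∀ p : ℝ, 0 ≤ p → (2 : ℝ≥0∞) ^ p ≠ ∞ := fun p hp =>
      ENNReal.rpow_ne_top_of_nonneg hp (by norm_num)
    exact ENNReal.mul_ne_top (h2 _ (by linarith)) (ENNReal.add_ne_top.mpr
      ⟨hLs', ENNReal.mul_ne_top (h2 _ hq0.le) hM⟩)

lemma ofReal_rpow_le_one_add_sq {q y : ℝ} (hq1 : 1 ≤ q) (hq2 : q ≤ 2) (hy : 0 ≤ y) :
    ENNReal.ofReal y ^ q ≤ 1 + ENNReal.ofReal (y ^ 2) := by
  have hq0 : 0 ≤ q := by linarith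
  rw [ENNReal.ofReal_rpow_of_nonneg hy hq0, ← ENNReal.ofReal_one,
    ← ENNReal.ofReal_add zero_le_one (sq_nonneg y)]
  apply ENNReal.ofReal_le_ofReal
  rcases le_total y 1 with h | h
  · linarith [Real.rpow_le_one hy h hq0, sq_nonneg y]
  · have := Real.rpow_le_rpow_of_exponent_le h hq2
    rw [Real.rpow_two] at this
    linarith

/-- A path is in the Hölder space if its temporal coefficients are bounded and Hölder with
constants `H_ℓ`, its spatial functions with constants `A_ℓ`, and the series of the `(H_ℓ A_ℓ)^q`
converges with the weights `ℓ^((s'-s)q/d)`. -/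
lemma memHolder_stbp {Ω : Type*} {d : ℕ} {X : Set (EuclideanSpace ℝ (Fin d))} {T : Set ℝ}
    [IsFiniteMeasure (timeMeasure T)] {q s s' κ β : ℝ} (hq : 1 ≤ q) (hκ : 0 < κ) (hβ : 0 < β)
    {φ : ℕ → X → ℝ} {η : ℕ → T → Ω → ℝ} {ω : Ω} {A H : ℕ → ℝ} (hA0 : ∀ ℓ, 0 ≤ A ℓ)
    (hA : ∀ ℓ x, |φ ℓ x| ≤ A ℓ)
    (hA' : ∀ ℓ x x', |φ ℓ x - φ ℓ x'| ≤ A ℓ * ‖(x : EuclideanSpace ℝ (Fin d)) - x'‖ ^ β)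
    (hH0 : ∀ ℓ, 0 ≤ H ℓ) (hH : ∀ ℓ t, |η ℓ t ω| ≤ H ℓ)
    (hH' : ∀ ℓ t t', |η ℓ t ω - η ℓ t' ω| ≤ H ℓ * |(t : ℝ) - t'| ^ β)
    (hsum : ∑' ℓ : ℕ, ENNReal.ofReal (((ℓ : ℝ) + 1) ^ ((s' - s) / d * q)) *
      ENNReal.ofReal (H ℓ * A ℓ) ^ q ≠ ∞) :
    MemHolder β s' q (fun z : X × T => stbp q s κ φ η z ω) := by
  have hq0 : 0 < q := by linarith
  set N : ℝ≥0∞ := (timeMeasure T Set.univ * ENNReal.ofReal κ ^ q *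
    ∑' ℓ : ℕ, ENNReal.ofReal (((ℓ : ℝ) + 1) ^ ((s' - s) / d * q)) *
      ENNReal.ofReal (H ℓ * A ℓ) ^ q) ^ (1 / q) with hN
  have hNtop : N ≠ ∞ := ENNReal.rpow_ne_top_of_nonneg (by positivity)
    (ENNReal.mul_ne_top (ENNReal.mul_ne_top (measure_ne_top _ _)
      (ENNReal.rpow_ne_top_of_nonneg hq0.le ENNReal.ofReal_ne_top)) hsum)
  have hHA : ∀ ℓ, 0 ≤ H ℓ * A ℓ := fun ℓ => mul_nonneg (hH0 ℓ) (hA0 ℓ)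
  refine ⟨⟨N.toReal, fun z => ?_⟩, 2 * N.toReal, fun z z' => ?_⟩
  · rw [ENNReal.ofReal_toReal hNtop]
    refine (besovNormConst_le (s := s) (ρ := 1) hq hκ hHA fun ℓ => ?_).trans_eq (by
      rw [ENNReal.ofReal_one, mul_one])
    have hg : 0 ≤ κ * ((ℓ : ℝ) + 1) ^ (-tau d q s) := by positivity
    simp only [stbp]
    rw [mul_assoc _ (η ℓ z.2 ω), abs_mul, abs_of_nonneg hg, abs_mul, mul_one]
    exact mul_le_mul_of_nonneg_left
      (mul_le_mul (hH ℓ z.2) (hA ℓ z.1) (abs_nonneg _) (hH0 ℓ)) hg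
  · set y := ‖WithLp.toLp 2 ((z.1 : EuclideanSpace ℝ (Fin d)) - z'.1, (z.2 : ℝ) - z'.2)‖ with hy
    have hy0 : 0 ≤ y := norm_nonneg _
    have hy1 : ‖(z.1 : EuclideanSpace ℝ (Fin d)) - z'.1‖ ≤ y :=
      WithLp.norm_fst_le (EuclideanSpace ℝ (Fin d)) (WithLp.toLp 2
        ((z.1 : EuclideanSpace ℝ (Fin d)) - z'.1, (z.2 : ℝ) - z'.2))
    have hy2 : |(z.2 : ℝ) - z'.2| ≤ y :=
      WithLp.norm_snd_le (EuclideanSpace ℝ (Fin d)) (WithLp.toLp 2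
        ((z.1 : EuclideanSpace ℝ (Fin d)) - z'.1, (z.2 : ℝ) - z'.2))
    rw [mul_comm 2 N.toReal, mul_assoc, ENNReal.ofReal_mul ENNReal.toReal_nonneg,
      ENNReal.ofReal_toReal hNtop]
    refine besovNormConst_le (s := s) hq hκ hHA fun ℓ => ?_
    have hg : 0 ≤ κ * ((ℓ : ℝ) + 1) ^ (-tau d q s) := by positivity
    have e : (stbp q s κ φ η z ω - stbp q s κ φ η z' ω) ℓ =
        κ * ((ℓ : ℝ) + 1) ^ (-tau d q s) *
          ((η ℓ z.2 ω - η ℓ z'.2 ω) * φ ℓ z.1 + η ℓ z'.2 ω * (φ ℓ z.1 - φ ℓ z'.1)) := by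
      simp only [Pi.sub_apply, stbp]
      ring
    rw [e, abs_mul, abs_of_nonneg hg]
    refine mul_le_mul_of_nonneg_left ((abs_add_le _ _).trans ?_) hg
    rw [abs_mul, abs_mul]
    have h1 : |η ℓ z.2 ω - η ℓ z'.2 ω| ≤ H ℓ * y ^ β :=
      (hH' ℓ _ _).trans (mul_le_mul_of_nonneg_left
        (Real.rpow_le_rpow (abs_nonneg _) hy2 hβ.le) (hH0 ℓ))
    have h2 : |φ ℓ z.1 - φ ℓ z'.1| ≤ A ℓ * y ^ β :=
      (hA' ℓ _ _).trans (mul_le_mul_of_nonneg_left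
        (Real.rpow_le_rpow (norm_nonneg _) hy1 hβ.le) (hA0 ℓ))
    have h3 := mul_le_mul h1 (hA ℓ z.1) (abs_nonneg _) ((abs_nonneg _).trans h1)
    have h4 := mul_le_mul (hH ℓ z'.2) h2 (abs_nonneg _) (hH0 ℓ)
    linarith

lemma memHolder_zero {d : ℕ} {X : Set (EuclideanSpace ℝ (Fin d))} {T : Set ℝ} {β s q : ℝ}
    (hq : 1 ≤ q) : MemHolder β s q (fun _ : X × T => (0 : ℕ → ℝ)) := by
  have hq0 : 0 < q := by linarith
  have h : besovNormConst d T s q 0 = 0 := by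
    simp [besovNormConst, besovNorm, hq0]
  exact ⟨⟨0, fun z => by simp [h]⟩, 0, fun z z' => by simp [h]⟩

end STBP

open MeasureTheory
open scoped ENNReal

/-! ### Hölder continuity of the spatiotemporal Besov process -/

theorem mainTheorem9 {Ω : Type*} [MeasurableSpace Ω] (P : MeasureTheory.Measure Ω)
    [MeasureTheory.IsProbabilityMeasure P]
    (d : ℕ) (hd : 0 < d) (X : Set (EuclideanSpace ℝ (Fin d)))
    (T : Set ℝ) (hTmeas : MeasurableSet T) (hTpos : T ⊆ Set.Ici 0)
    (hTbdd : Bornology.IsBounded T)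
    [(STBP.timeMeasure T).IsOpenPosMeasure]
    (q s s' α κ : ℝ) (hq1 : 1 ≤ q) (hq2 : q ≤ 2) (hs : s' < s - d / q) (hα : 0 < α) (hκ : 0 < κ)
    (C : T → T → ℝ) (lam : ℕ → ℝ) (ψ : ℕ → T → ℝ) (φ : ℕ → X → ℝ) (ξ : ℕ → T → Ω → ℝ)
    (hC : STBP.IsEigenSystem C lam ψ)
    (hlam : Summable (fun j => lam j ^ (q / 2)))
    (hξ : STBP.IsIIDQEP P q C lam ψ ξ)
    (hφ : STBP.SpatialHolder q s s' α φ)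
    (hψ : STBP.TemporalHolder d q α lam ψ) :
    ∀ β : ℝ, 0 < β → β < α →
      ∃ v : X × T → Ω → ℕ → ℝ,
        (∀ z, Measurable (v z)) ∧
        (∀ z, ∀ᵐ ω ∂P, v z ω = STBP.stbp q s κ φ ξ z ω) ∧
        (∀ ω, STBP.MemHolder β s' q (fun z => v z ω)) := by
  classical
  intro β hβ hβα
  have hfin := STBP.isFiniteMeasure_timeMeasure hTmeas hTbdd
  have hne : Nonempty T := ⟨(hC.exists_abs_le 0).choose⟩
  have hq0 : 0 < q := by linarith
  -- second moments suffice in one time dimension, since `2 (α + d / q) ≥ 1 + 2 α`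
  have hγ : β < α + d / q - 1 / 2 := by
    have h1 : (1 : ℝ) ≤ d := by exact_mod_cast hd
    have h2 : (1 : ℝ) / 2 ≤ d / q := by
      rw [div_le_div_iff₀ two_pos hq0]
      linarith
    linarith
  obtain ⟨K, hK, hKξ⟩ := STBP.exists_lintegral_sq_le P hTmeas hTbdd hq1 hq2 hα hC hlam hψ
  obtain ⟨K', hK', hver⟩ := STBP.exists_holder_version P (fun t : T => hTpos t.2) hTbdd hβ hγ hK
  have hver' : ∀ ℓ, _ := fun ℓ => hver (ξ ℓ) (hξ.1 ℓ).1 (hKξ _ (hξ.1 ℓ)).1 (fun t t' => by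
    have := (hKξ _ (hξ.1 ℓ)).2 t t'
    rwa [show 1 + 2 * (α + d / q - 1 / 2) = 2 * (α + d / q) by ring])
  choose η H hηm hHm hηξ hH0 hH hH' hHint using hver'
  obtain ⟨A, hA0, hA, hA', hAs⟩ := hφ.exists_bounds hq1 hβ hβα
  set W : ℕ → ℝ≥0∞ := fun ℓ => ENNReal.ofReal (((ℓ : ℝ) + 1) ^ ((s' - s) / d * q)) with hW
  set S : Ω → ℝ≥0∞ := fun ω => ∑' ℓ : ℕ, W ℓ * ENNReal.ofReal (H ℓ ω * A ℓ) ^ q with hS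
  have hSm' : ∀ ℓ, Measurable fun ω => W ℓ * ENNReal.ofReal (H ℓ ω * A ℓ) ^ q := fun ℓ =>
    (((hHm ℓ).mul_const _).ennreal_ofReal.pow_const q).const_mul _
  have hSm : Measurable S := Measurable.tsum hSm'
  have hSint : ∫⁻ ω, S ω ∂P ≤ (1 + K') * ∑' ℓ : ℕ, W ℓ * ENNReal.ofReal (A ℓ) ^ q := by
    rw [hS, lintegral_tsum fun ℓ => (hSm' ℓ).aemeasurable, ← ENNReal.tsum_mul_left]
    refine ENNReal.tsum_le_tsum fun ℓ => ?_
    have hAtop : W ℓ * ENNReal.ofReal (A ℓ) ^ q ≠ ∞ := ENNReal.ne_top_of_tsum_ne_top hAs ℓ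
    calc ∫⁻ ω, W ℓ * ENNReal.ofReal (H ℓ ω * A ℓ) ^ q ∂P
        ≤ ∫⁻ ω, (1 + ENNReal.ofReal (H ℓ ω ^ 2)) * (W ℓ * ENNReal.ofReal (A ℓ) ^ q) ∂P := by
          refine lintegral_mono fun ω => ?_
          rw [ENNReal.ofReal_mul (hH0 ℓ ω), ENNReal.mul_rpow_of_nonneg _ _ hq0.le, mul_left_comm]
          gcongr
          exact STBP.ofReal_rpow_le_one_add_sq hq1 hq2 (hH0 ℓ ω)
      _ = (1 + ∫⁻ ω, ENNReal.ofReal (H ℓ ω ^ 2) ∂P) * (W ℓ * ENNReal.ofReal (A ℓ) ^ q) := by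
          rw [lintegral_mul_const' _ _ hAtop, lintegral_add_left measurable_const]
          simp
      _ ≤ _ := by
          gcongr
          exact hHint ℓ
  have hStop : ∀ᵐ ω ∂P, S ω < ∞ := ae_lt_top hSm (ne_top_of_le_ne_top
    (ENNReal.mul_ne_top (ENNReal.add_ne_top.mpr ⟨ENNReal.one_ne_top, hK'⟩) hAs) hSint)
  refine ⟨fun z ω => if S ω < ∞ then STBP.stbp q s κ φ η z ω else 0, fun z => ?_, fun z => ?_,
    fun ω => ?_⟩
  · refine Measurable.ite (measurableSet_lt hSm measurable_const)
      (measurable_pi_lambda _ fun ℓ => ?_) measurable_const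
    exact ((hηm ℓ z.2).const_mul _).mul_const _
  · filter_upwards [hStop, ae_all_iff.mpr fun ℓ => hηξ ℓ z.2] with ω h1 h2
    rw [if_pos h1]
    funext ℓ
    simp only [STBP.stbp, h2 ℓ]
  · by_cases hω : S ω < ∞
    · simp only [if_pos hω]
      exact STBP.memHolder_stbp hq1 hκ hβ hA0 hA hA' (fun ℓ => hH0 ℓ ω) (fun ℓ t => hH ℓ t ω)
        (fun ℓ t t' => hH' ℓ t t' ω) hω.ne
    · simp only [if_neg hω]
      exact STBP.memHolder_zero hq1
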